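/- Call a sequence of functions $(G_n)_{n\ge 0}$, each holomorphic on $\mathbb C\setminus\{0,-1,-2,\dots\}$, a *hierarchy of multiple gamma functions* if (1) $G_{n}(z+1)=G_{n-1}(z)\,G_{n}(z)$ for $n\ge 1$ and $z\notin\{0,-1,-2,\dots\}$; (2) $G_n(1)=1$ for all $n\ge 0$; (3) for every $n\ge 0$ and real $x\ge 0$, $G_n(x+1)$ is real and positive and $\frac{d^{n+1}}{dx^{n+1}}\log G_n(x+1)\ge 0$; (4) $G_0(z)=z$. Notation: $B_m(t)$ are the Bernoulli polynomials, $\frac{x e^{tx}}{e^x-1}=\sum_{m\ge0}B_m(t)\frac{x^m}{m!}$, and $B_m=B_m(0)$ (so $B_1=-\tfrac12$); $\binom{x}{m}=\frac{x(x-1)\cdots(x-m+1)}{m!}$; the Stirling numbers of the first kind ${}_mS_r$ are given by $u(u-1)\cdots(u-m+1)=\sum_{r=0}^m {}_mS_r\,u^r$; the polynomials $G_{n,j}$ are given by $\binom{z-u}{n-1}=\sum_{j=0}^{n-1}G_{n,j}(z)u^j$; $\zeta$ is the Riemann zeta function and $\gamma$ is Euler's constant. For $n\ge1$ put $$F_n(z)=\sum_{j=0}^{n-1}G_{n,j}(z)Q_j(z)+\sum_{r=0}^{n-2}\left[\frac1{r!}\Big(\frac{\partial}{\partial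 u}\Big)^r\binom{z-u}{n-1}\right]_{u=0}^{u=z}\zeta'(-r)-\gamma\int_0^z\binom{z-u}{n-1}\,du,$$ $$\Phi_n(z,k)=\frac1{(n-1)!}\sum_{\mu=-1}^{n-2}\left\{\sum_{r=\mu+1}^{n-1}\frac{{}_{n-1}S_r}{r-\mu}z^{r-\mu}\right\}(-1)^{\mu+1}k^{\mu},$$ $$Q_j(z)=P_j(z+1)-\sum_{r=0}^j\binom jr z^rP_{j-r}(1)+\frac1{j+1}\sum_{r=1}^{j+1}\binom{j+1}{r}B_{j+1-r}(z)\sum_{l=1}^r\frac{(-1)^{l-1}z^l}{l},$$ $$P_j(x)=\sum_{r=0}^{j+1}\frac{B_r}{r!}\varphi_{j,r}\,x^{j-r+1},\qquad \varphi_{j,r}=\Big(\frac{d}{dt}\Big)^r\left\{\frac{t^{j+1}}{j+1}\log t-\frac{t^{j+1}}{(j+1)^2}\right\}\Bigg|_{t=1}.$$ **Theorem.** A hierarchy of multiple gamma functions exists, and for every such hierarchy, every integer $n\ge 1$ and every $z\in\mathbb C\setminus\{-1,-2,-3,\dots\}$, $$G_n(z+1)=\exp(F_n(z))\prod_{k=1}^\infty\left\{\Big(1+\frac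 zk\Big)^{-\binom{-k}{n-1}}\exp\big(\Phi_n(z,k)\big)\right\},$$ where the infinite product converges absolutely, i.e. if $a_k$ denotes its $k$-th factor then $\sum_{k\ge1}|a_k-1|<\infty$. -/

import Mathlib

open scoped Polynomial

/-- A hierarchy of multiple gamma functions `G₀, G₁, G₂, …`: functions holomorphic on
`ℂ ∖ {0, -1, -2, …}` (values of `G n` at the points `0, -1, -2, …` are irrelevant for `n ≥ 1`) with
`G₀(z) = z`, `Gₙ(z + 1) = Gₙ₋₁(z) Gₙ(z)`, `Gₙ(1) = 1`, and
`(d/dx)ⁿ⁺¹ log Gₙ(x + 1) ≥ 0` for real `x ≥ 0`.  The last condition includes that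
`Gₙ(x + 1)` is real and positive there, so that the real logarithm makes sense. -/
structure IsMultipleGammaHierarchy (G : ℕ → ℂ → ℂ) : Prop where
  holomorphic : ∀ n, DifferentiableOn ℂ (G n) {z | ∀ m : ℕ, z ≠ -(m : ℂ)}
  zero : ∀ z, G 0 z = z
  add_one : ∀ n z, (∀ m : ℕ, z ≠ -(m : ℂ)) → G (n + 1) (z + 1) = G n z * G (n + 1) z
  one : ∀ n, G n 1 = 1
  real_pos : ∀ n (x : ℝ), 0 ≤ x → (G n ((x : ℂ) + 1)).im = 0 ∧ 0 < (G n ((x : ℂ) + 1)).re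
  log_deriv_nonneg : ∀ n (x : ℝ), 0 ≤ x →
    0 ≤ iteratedDeriv (n + 1) (fun t : ℝ => Real.log (G n ((t : ℂ) + 1)).re) x

namespace MultipleGamma

noncomputable section

/-- The polynomials `G_{n,j}(z)` given by `binom(z - u, n - 1) = ∑_{j=0}^{n-1} G_{n,j}(z) u^j`,
i.e. the coefficient of `u^j` in the polynomial `binom(z - u, n - 1) ∈ ℂ[u]`. -/
def coeffG (n j : ℕ) (z : ℂ) : ℂ :=
  (Ring.choose (Polynomial.C z - Polynomial.X : ℂ[X]) (n - 1)).coeff j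

/-- `φ_{j,r} = (d/dt)^r { t^{j+1}/(j+1) · log t - t^{j+1}/(j+1)² }` at `t = 1`. -/
def phi (j r : ℕ) : ℝ :=
  iteratedDeriv r
    (fun t : ℝ => t ^ (j + 1) / (j + 1) * Real.log t - t ^ (j + 1) / ((j : ℝ) + 1) ^ 2) 1

/-- `P_j(x) = ∑_{r=0}^{j+1} B_r / r! · φ_{j,r} x^{j-r+1}`, with `B_1 = -1/2`. -/
def P (j : ℕ) (x : ℂ) : ℂ :=
  ∑ r ∈ Finset.range (j + 2),
    (_root_.bernoulli r : ℂ) / (r.factorial : ℂ) * (phi j r : ℂ) * x ^ (j + 1 - r)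

/-- The Bernoulli polynomial `B_m(z)` at a complex number. -/
def bernoulliPoly (m : ℕ) (z : ℂ) : ℂ :=
  Polynomial.aeval z (Polynomial.bernoulli m)

/-- `Q_j(z) = P_j(z+1) - ∑_{r=0}^{j} binom(j,r) z^r P_{j-r}(1)
  + 1/(j+1) ∑_{r=1}^{j+1} binom(j+1,r) B_{j+1-r}(z) ∑_{l=1}^{r} (-1)^{l-1} z^l / l`. -/
def Q (j : ℕ) (z : ℂ) : ℂ :=
  P j (z + 1) - ∑ r ∈ Finset.range (j + 1), (j.choose r : ℂ) * z ^ r * P (j - r) 1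
    + 1 / ((j : ℂ) + 1) * ∑ r ∈ Finset.Icc 1 (j + 1),
        ((j + 1).choose r : ℂ) * bernoulliPoly (j + 1 - r) z *
          ∑ l ∈ Finset.Icc 1 r, (-1 : ℂ) ^ (l - 1) * z ^ l / (l : ℂ)

/-- The polynomial in the exponential prefactor, for `n ≥ 1`. The last integral is the contour
integral of `u ↦ binom(z - u, n - 1)` along the segment from `0` to `z`. -/
def F (n : ℕ) (z : ℂ) : ℂ :=
  ∑ j ∈ Finset.range n, coeffG n j z * Q j z
    + ∑ r ∈ Finset.range (n - 1),
        (1 / (r.factorial : ℂ) *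
            iteratedDeriv r (fun u : ℂ => Ring.choose (z - u) (n - 1)) z
          - 1 / (r.factorial : ℂ) *
            iteratedDeriv r (fun u : ℂ => Ring.choose (z - u) (n - 1)) 0)
        * deriv riemannZeta (-(r : ℂ))
    - (∫ t in (0 : ℝ)..1, Ring.choose (z - (t : ℂ) * z) (n - 1) * z)
        * (Real.eulerMascheroniConstant : ℂ)

/-- The (signed) Stirling number of the first kind `ₙS_j`: the coefficient of `u^j` in
`u (u - 1) ⋯ (u - n + 1)`. -/
def stirlingS (n j : ℕ) : ℤ :=
  (descPochhammer ℤ n).coeff j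

/-- `Φ_n(z,k) = 1/(n-1)! ∑_{μ=-1}^{n-2} { ∑_{r=μ+1}^{n-1} ₙ₋₁S_r / (r-μ) · z^{r-μ} } (-1)^{μ+1} k^μ`,
written with the index `m = μ + 1` running from `0` to `n - 1`. -/
def Phi (n : ℕ) (z : ℂ) (k : ℕ) : ℂ :=
  1 / ((n - 1).factorial : ℂ) * ∑ m ∈ Finset.range n,
    (∑ r ∈ Finset.Ico m n,
      (stirlingS (n - 1) r : ℂ) / ((r + 1 - m : ℕ) : ℂ) * z ^ (r + 1 - m))
    * (-1 : ℂ) ^ m * (k : ℂ) ^ ((m : ℤ) - 1)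

/-- The `k`-th factor `(1 + z/k)^{-binom(-k, n-1)} exp Φ_n(z,k)`; the exponent is an integer. -/
def weierstrassFactor (n : ℕ) (z : ℂ) (k : ℕ) : ℂ :=
  (1 + z / (k : ℂ)) ^ (-Ring.choose (-(k : ℤ)) (n - 1)) * Complex.exp (Phi n z k)

end

end MultipleGamma

section

open Filter Topology MultipleGamma

/-! On the real half-line the logarithm of the solution is a finite combination of Hurwitz zeta
derivatives: log G_{m+1}(x+1) = ∑_j G_{m+1,j}(x) (ζ'(-j, x+1) - ζ'(-j)), which is
`logMultipleGamma`. Since ζ'(-j, y+1) = ζ'(-j, y) + y^j log y, a shift of x contributes only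
binom(0,m) log(x+1), and Pascal's rule for the coefficients turns this into the recursion between
consecutive levels.

For the product formula, Euler–Maclaurin presents ζ'(-j, y) as the limit of the elementary
expressions `zetaDerivApprox`. At y = x+1, split log(x+1+k) = log(k+1) + log(1 + x/(k+1)). The first
parts reassemble into the values ζ'(-r), and harmonic numbers against log N give γ. The second parts
give the logarithms in the product, with their truncated expansions subtracted to force convergence
(`zetaDerivApprox_sub`). What is left over depends on the cutoff N with polynomial increments. All
other terms converge, so it converges too; polynomial increments tending to 0 vanish, and the
leftover equals its value Q_j(x) at N = 0 (`tendsto_zetaDerivApprox`). After summation over j the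
powers (z+k)^j collapse to binom(-k,m), free of z (`binomPoly_zero_eq_sum`). The exponents are
therefore integers and the product is single-valued.

The product is holomorphic because its factors are 1 + O(k⁻²) uniformly on bounded sets. F and Φ
have degree at most m+1 in z, so the (m+2)-nd derivative of the logarithm is a series of nonnegative
terms, which also tends to 0 at infinity (`hasSum_derivTerm`, `tendsto_iteratedDeriv_logW`).

Uniqueness is a Bohr–Mollerup argument (`sub_eq_const_of_iteratedDeriv_nonneg`), applied inductively
in n and carried from the real axis to the complex domain by the identity theorem. -/

/-! ### Euler–Maclaurin summation and a convergence criterion. -/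

/-- One step of the Euler–Maclaurin formula for a tower of successive derivatives `g r`. -/
theorem eulerMaclaurin_step (g : ℕ → ℝ → ℂ) (w : ℝ)
    (hg : ∀ r, ∀ t ∈ Set.Icc w (w + 1), HasDerivAt (g r) (g (r + 1) t) t) (M : ℕ) :
    ∑ r ∈ Finset.range (M + 1), (bernoulli r : ℂ) / (r.factorial : ℂ) * (g r (w + 1) - g r w) =
      (if M = 0 then 0 else g 1 w) +
        ∫ t in (0 : ℝ)..1, ((bernoulliFun M (1 - t) / (M.factorial : ℝ) : ℝ) : ℂ) *
          g (M + 1) (w + t) := by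
  have hgt : ∀ r, ∀ t ∈ Set.uIcc (0 : ℝ) 1, HasDerivAt (fun t => g r (w + t)) (g (r + 1) (w + t)) t := by
    intro r t ht
    rw [Set.uIcc_of_le zero_le_one] at ht
    have := (hg r (w + t) ⟨by linarith [ht.1], by linarith [ht.2]⟩).comp_const_add w t
    simpa using this
  have hcont : ∀ r, ContinuousOn (fun t => g r (w + t)) (Set.uIcc (0 : ℝ) 1) := fun r t ht =>
    (hgt r t ht).continuousAt.continuousWithinAt
  induction M with
  | zero =>
    have h0 : ∀ t : ℝ, bernoulliFun 0 t = 1 := by intro t; simp [bernoulliFun]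
    have := intervalIntegral.integral_eq_sub_of_hasDerivAt (hgt 0) (hcont 1).intervalIntegrable
    simp only [h0]
    simp at this ⊢
    exact this.symm
  | succ M ih =>
    rw [Finset.sum_range_succ, ih]
    have hb : ∀ t ∈ Set.uIcc (0 : ℝ) 1, HasDerivAt
        (fun t : ℝ => (((-(bernoulliFun (M + 1) (1 - t) / ((M + 1).factorial : ℝ))) : ℝ) : ℂ))
        ((bernoulliFun M (1 - t) / (M.factorial : ℝ) : ℝ) : ℂ) t := by
      intro t _
      have h1 := (hasDerivAt_bernoulliFun (M + 1) (1 - t))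
      have h2 : HasDerivAt (fun t : ℝ => 1 - t) (-1) t := by
        simpa using (hasDerivAt_id t).const_sub 1
      have h3 := ((h1.comp t h2).div_const ((M + 1).factorial : ℝ)).neg.ofReal_comp
      refine HasDerivAt.congr_deriv h3 ?_
      have h4 : (M.factorial : ℝ) ≠ 0 := by exact_mod_cast M.factorial_ne_zero
      have h5 : (M + 1 : ℝ) ≠ 0 := by exact_mod_cast M.succ_ne_zero
      rw [Complex.ofReal_inj, Nat.factorial_succ, Nat.add_sub_cancel]
      push_cast
      field_simp
    have hbc : ∀ m : ℕ, Continuous (fun t : ℝ => ((bernoulliFun m (1 - t) / (m.factorial : ℝ) : ℝ) : ℂ)) := by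
      intro m
      have : Continuous (bernoulliFun m) := by unfold bernoulliFun; fun_prop
      fun_prop
    have key := intervalIntegral.integral_mul_deriv_eq_deriv_mul hb (hgt (M + 1))
      (hbc M).continuousOn.intervalIntegrable (hcont (M + 2)).intervalIntegrable
    simp only [Complex.ofReal_neg, neg_mul, intervalIntegral.integral_neg] at key
    have e1 : bernoulliFun (M + 1) (1 - 1) = bernoulli (M + 1) := by
      rw [sub_self, bernoulliFun_eval_zero]
    -- Among the Bernoulli polynomials of positive index only B₁ takes different values at 0 and 1;
    -- this is the source of the isolated term `g 1 w`, created in the passage from M = 0 to M = 1.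
    have e0 : bernoulliFun (M + 1) (1 - 0) = bernoulli (M + 1) + if M = 0 then 1 else 0 := by
      rw [sub_zero, bernoulliFun_eval_one, bernoulliFun_eval_zero]; simp
    rw [e1, e0] at key
    rw [if_neg (Nat.succ_ne_zero M), neg_eq_iff_eq_neg.mp key]
    rcases eq_or_ne M 0 with rfl | hM
    · simp; ring
    · simp [hM]; ring

/-- The Weierstrass M-test for the telescoping series of increments, with a majorant that may depend
on the compact set. -/
theorem TendstoLocallyUniformlyOn.of_summable_sub {F : ℕ → ℂ → ℂ} {U : Set ℂ} (hU : IsOpen U)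
    (h : ∀ K ⊆ U, IsCompact K → ∃ u : ℕ → ℝ, Summable u ∧
      ∀ᶠ N in atTop, ∀ s ∈ K, ‖F (N + 1) s - F N s‖ ≤ u N) :
    TendstoLocallyUniformlyOn F (fun s => F 0 s + ∑' N, (F (N + 1) s - F N s)) atTop U := by
  rw [tendstoLocallyUniformlyOn_iff_forall_isCompact hU]
  intro K hKU hK
  obtain ⟨u, hu, hb⟩ := h K hKU hK
  have h1 := tendstoUniformlyOn_tsum_nat_eventually hu hb
  rw [Metric.tendstoUniformlyOn_iff] at h1 ⊢
  intro ε hε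
  filter_upwards [h1 ε hε] with N hN s hs
  have := hN s hs
  rw [Finset.sum_range_sub (fun N => F N s)] at this
  rw [dist_eq_norm] at this ⊢
  convert this using 2
  ring

namespace MultipleGamma

/-! ### The Hurwitz zeta function near s = -j and its derivative as a limit. -/

/-- The falling product `(1 - s)(-s)⋯(2 - s - r)` that arises on differentiating `t ^ (1 - s)`. -/
noncomputable def powDerivCoeff (r : ℕ) (s : ℂ) : ℂ := ∏ i ∈ Finset.range r, (1 - s - i)

theorem powDerivCoeff_succ (r : ℕ) (s : ℂ) :
    powDerivCoeff (r + 1) s = powDerivCoeff r s * (1 - s - r) := Finset.prod_range_succ _ _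

theorem differentiable_powDerivCoeff (r : ℕ) : Differentiable ℂ (powDerivCoeff r) := by
  induction r with
  | zero =>
    have : powDerivCoeff 0 = fun _ => 1 := by ext s; simp [powDerivCoeff]
    rw [this]; fun_prop
  | succ r ih =>
    have : powDerivCoeff (r + 1) = fun s => powDerivCoeff r s * (1 - s - r) := by
      ext s; exact powDerivCoeff_succ r s
    rw [this]; fun_prop

/-- Partial sums of `(s - 1) ζ(s, y)` with `M` Euler–Maclaurin correction terms. -/
noncomputable def zetaPartial (M N : ℕ) (y : ℝ) (s : ℂ) : ℂ :=
  (s - 1) * ∑ k ∈ Finset.range N, ((y + k : ℝ) : ℂ) ^ (-s) +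
    ∑ r ∈ Finset.range (M + 1), (bernoulli r : ℂ) / (r.factorial : ℂ) *
      (powDerivCoeff r s * ((y + N : ℝ) : ℂ) ^ (1 - s - r))

theorem hasDerivAt_powDerivCoeff_mul_cpow (r : ℕ) (s : ℂ) {t : ℝ} (ht : 0 < t) :
    HasDerivAt (fun t : ℝ => powDerivCoeff r s * (t : ℂ) ^ (1 - s - r))
      (powDerivCoeff (r + 1) s * (t : ℂ) ^ (1 - s - (r + 1 : ℕ))) t := by
  have h1 : HasDerivAt (fun t : ℝ => (t : ℂ)) 1 t := (hasDerivAt_id t).ofReal_comp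
  have h2 : HasDerivAt (fun z : ℂ => z ^ (1 - s - r)) ((1 - s - r) * (t : ℂ) ^ (1 - s - r - 1) * 1)
      (t : ℂ) := (hasDerivAt_id (t : ℂ)).cpow_const (Or.inl (by simpa using ht))
  have h3 := (h2.comp_ofReal).const_mul (powDerivCoeff r s)
  refine h3.congr_deriv ?_
  rw [powDerivCoeff_succ, show (1 - s - (r + 1 : ℕ) : ℂ) = 1 - s - r - 1 by push_cast; ring]
  ring

/-- The Euler–Maclaurin step is applied to the derivatives of t^(1-s). Its isolated term
(1-s)(y+N)^(-s) cancels the new summand of the partial sum, so only the remainder integral survives.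
Working with (s-1)ζ(s,y) avoids the pole at s = 1. -/
theorem zetaPartial_succ_sub (M N : ℕ) (hM : M ≠ 0) {y : ℝ} (hy : 0 < y) (s : ℂ) :
    zetaPartial M (N + 1) y s - zetaPartial M N y s =
      ∫ t in (0 : ℝ)..1, ((bernoulliFun M (1 - t) / (M.factorial : ℝ) : ℝ) : ℂ) *
        (powDerivCoeff (M + 1) s * ((y + N + t : ℝ) : ℂ) ^ (1 - s - (M + 1 : ℕ))) := by
  have hw : 0 < y + N := by positivity
  have key := eulerMaclaurin_step (fun r t => powDerivCoeff r s * (t : ℂ) ^ (1 - s - r)) (y + N)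
    (fun r t ht => hasDerivAt_powDerivCoeff_mul_cpow r s (hw.trans_le ht.1)) M
  rw [if_neg hM] at key
  have e1 : powDerivCoeff 1 s = 1 - s := by simp [powDerivCoeff]
  simp only [e1, mul_sub, Finset.sum_sub_distrib] at key
  have e2 : (1 - s - (1 : ℕ) : ℂ) = -s := by push_cast; ring
  rw [e2] at key
  unfold zetaPartial
  rw [Finset.sum_range_succ]
  have e3 : (y + (N + 1 : ℕ) : ℝ) = y + N + 1 := by push_cast; ring
  rw [e3]
  linear_combination key

/-- The remainder integrand carries the power -s-M, whose real part is at most -3/2 in this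
half-plane; hence a summable bound. The case N = 0 must be excluded because `(0 : ℝ) ^ (-(3 / 2))`
is 0. -/
theorem norm_zetaPartial_succ_sub_le (M : ℕ) (hM : M ≠ 0) : ∃ C, ∀ (N : ℕ) (y : ℝ) (s : ℂ), 0 < y →
    1 ≤ N → 3 / 2 - (M : ℝ) ≤ s.re →
    ‖zetaPartial M (N + 1) y s - zetaPartial M N y s‖ ≤
      C * ‖powDerivCoeff (M + 1) s‖ * (N : ℝ) ^ (-(3 / 2) : ℝ) := by
  have hc : Continuous fun t : ℝ => bernoulliFun M (1 - t) / (M.factorial : ℝ) := by fun_prop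
  obtain ⟨C, hC⟩ := (isCompact_Icc (a := (0 : ℝ)) (b := 1)).exists_bound_of_continuousOn
    hc.continuousOn
  refine ⟨C, fun N y s hy hN hs => ?_⟩
  rw [zetaPartial_succ_sub M N hM hy s]
  have hN' : (1 : ℝ) ≤ N := by exact_mod_cast hN
  refine (intervalIntegral.norm_integral_le_of_norm_le_const
    (C := C * ‖powDerivCoeff (M + 1) s‖ * (N : ℝ) ^ (-(3 / 2) : ℝ)) fun t ht => ?_).trans (by simp)
  rw [Set.uIoc_of_le zero_le_one] at ht
  have h1 := hC t ⟨ht.1.le, ht.2⟩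
  rw [norm_mul, norm_mul, Complex.norm_real, mul_assoc]
  have h2 : ‖((y + N + t : ℝ) : ℂ) ^ (1 - s - (M + 1 : ℕ))‖ ≤ (N : ℝ) ^ (-(3 / 2) : ℝ) := by
    rw [Complex.norm_cpow_eq_rpow_re_of_pos (by linarith [ht.1])]
    calc (y + N + t) ^ (1 - s - (M + 1 : ℕ)).re ≤ (y + N + t) ^ (-(3 / 2) : ℝ) := by
          apply Real.rpow_le_rpow_of_exponent_le (by linarith [ht.1])
          simp; linarith
      _ ≤ _ := Real.rpow_le_rpow_of_nonpos (by linarith) (by linarith [ht.1]) (by norm_num)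
  have hC0 : 0 ≤ C := (norm_nonneg _).trans h1
  gcongr

theorem tendstoLocallyUniformlyOn_zetaPartial (M : ℕ) (hM : M ≠ 0) {y : ℝ} (hy : 0 < y) :
    TendstoLocallyUniformlyOn (fun N => zetaPartial M N y)
      (fun s => zetaPartial M 0 y s + ∑' N, (zetaPartial M (N + 1) y s - zetaPartial M N y s))
      atTop {s : ℂ | 3 / 2 - (M : ℝ) < s.re} := by
  refine TendstoLocallyUniformlyOn.of_summable_sub
    (isOpen_lt continuous_const Complex.continuous_re) fun K hKU hK => ?_
  obtain ⟨C, hC⟩ := norm_zetaPartial_succ_sub_le M hM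
  obtain ⟨D, hD⟩ := hK.exists_bound_of_continuousOn
    (differentiable_powDerivCoeff (M + 1)).continuous.continuousOn
  refine ⟨fun N => |C| * D * (N : ℝ) ^ (-(3 / 2) : ℝ),
    (Real.summable_nat_rpow.mpr (by norm_num)).mul_left _, ?_⟩
  filter_upwards [eventually_ge_atTop 1] with N hN s hs
  have hD1 := hD s hs
  refine (hC N y s hy hN (hKU hs).le).trans ?_
  gcongr
  exact le_abs_self C

theorem differentiable_zetaPartial (M N : ℕ) {y : ℝ} (hy : 0 < y) :
    Differentiable ℂ (zetaPartial M N y) := by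
  unfold zetaPartial
  have h : ∀ k : ℕ, ((y + k : ℝ) : ℂ) ≠ 0 := fun k => by
    rw [Complex.ofReal_ne_zero]; positivity
  have h1 : ∀ (k : ℕ) (f : ℂ → ℂ), Differentiable ℂ f →
      Differentiable ℂ fun s => ((y + k : ℝ) : ℂ) ^ (f s) := fun k f hf =>
    hf.const_cpow (Or.inl (h k))
  have h2 := differentiable_powDerivCoeff
  refine Differentiable.add ?_ ?_
  · refine Differentiable.mul (by fun_prop) (Differentiable.fun_sum fun k _ => h1 k _ (by fun_prop))
  · exact Differentiable.fun_sum fun r _ => ((h2 r).mul (h1 N _ (by fun_prop))).const_mul _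

theorem tendsto_zetaPartial_of_one_lt_re (M : ℕ) {s : ℂ} (hs : 1 < s.re) :
    Tendsto (fun N => zetaPartial M N 1 s) atTop (𝓝 (riemannZeta₁ s)) := by
  have hs1 : s ≠ 1 := by rintro rfl; simp at hs
  have h1 : riemannZeta₁ s = (s - 1) * riemannZeta s + ∑ r ∈ Finset.range (M + 1), 0 := by
    rw [riemannZeta_eq_inv_sub_mul hs1]; have := sub_ne_zero_of_ne hs1; simp; field_simp
  rw [h1]
  refine Tendsto.add (Tendsto.const_mul _ ?_) (tendsto_finsetSum _ fun r _ => ?_)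
  · rw [zeta_eq_tsum_one_div_nat_add_one_cpow hs]
    have h2 : Summable fun n : ℕ => 1 / (n + 1 : ℂ) ^ s := by
      have := (summable_nat_add_iff 1).mpr (Complex.summable_one_div_nat_cpow.mpr hs)
      simpa using this
    refine h2.hasSum.tendsto_sum_nat.congr fun N => Finset.sum_congr rfl fun k _ => ?_
    rw [Complex.cpow_neg, one_div]; push_cast; rw [add_comm]
  · rw [show (0 : ℂ) = (bernoulli r : ℂ) / (r.factorial : ℂ) * (powDerivCoeff r s * 0) by simp]
    refine Tendsto.const_mul _ (Tendsto.const_mul _ ?_)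
    rw [tendsto_zero_iff_norm_tendsto_zero]
    have h3 : ∀ N : ℕ, ‖((1 + N : ℝ) : ℂ) ^ (1 - s - r)‖ = ((N : ℝ) + 1) ^ (-(s.re + r - 1)) := by
      intro N
      rw [Complex.norm_cpow_eq_rpow_re_of_pos (by positivity), add_comm]
      congr 1; simp; ring
    simp only [h3]
    have h4 : 0 < s.re + r - 1 := by have : (0:ℝ) ≤ r := by positivity
                                     linarith
    exact (tendsto_rpow_neg_atTop h4).comp
      (tendsto_atTop_add_const_right _ _ tendsto_natCast_atTop_atTop)

/-- Both sides are holomorphic on a convex half-plane containing 2 and agree for Re s > 1, where the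
correction terms die out. Identification with a known function is needed only for y = 1; for other y
the existence of the limit is enough. -/
theorem zetaPartial_limit_eqOn (M : ℕ) (hM : M ≠ 0) :
    Set.EqOn (fun s => zetaPartial M 0 1 s + ∑' N, (zetaPartial M (N + 1) 1 s - zetaPartial M N 1 s))
      riemannZeta₁ {s : ℂ | 3 / 2 - (M : ℝ) < s.re} := by
  have hU : IsOpen {s : ℂ | 3 / 2 - (M : ℝ) < s.re} := isOpen_lt continuous_const Complex.continuous_re
  have hlim := tendstoLocallyUniformlyOn_zetaPartial M hM one_pos
  have hd := hlim.differentiableOn (.of_forall fun N =>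
    (differentiable_zetaPartial M N one_pos).differentiableOn) hU
  have hM1 : (1 : ℝ) ≤ M := by exact_mod_cast Nat.one_le_iff_ne_zero.mpr hM
  have h2 : (2 : ℂ) ∈ {s : ℂ | 3 / 2 - (M : ℝ) < s.re} := by
    simp; linarith
  refine (hd.analyticOnNhd hU).eqOn_of_preconnected_of_eventuallyEq
    (differentiable_riemannZeta₁.differentiableOn.analyticOnNhd hU)
    (convex_halfSpace_re_gt _).isPreconnected h2 ?_
  have h3 : {s : ℂ | 1 < s.re} ∈ 𝓝 (2 : ℂ) :=
    (isOpen_lt continuous_const Complex.continuous_re).mem_nhds (by simp)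
  filter_upwards [h3] with s hs
  have hs' : (1 : ℝ) < s.re := hs
  exact tendsto_nhds_unique (hlim.tendsto_at (show 3 / 2 - (M : ℝ) < s.re by linarith))
    (tendsto_zetaPartial_of_one_lt_re M hs)

theorem powDerivCoeff_neg_natCast (j r : ℕ) :
    powDerivCoeff r (-(j : ℂ)) = ((j + 1).descFactorial r : ℂ) := by
  induction r with
  | zero => simp [powDerivCoeff]
  | succ r ih =>
    rw [powDerivCoeff_succ, ih, Nat.descFactorial_succ]
    rcases le_or_gt r (j + 1) with h | h
    · push_cast [Nat.cast_sub h]; ring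
    · rw [Nat.descFactorial_of_lt h]; simp

theorem deriv_powDerivCoeff_succ (r : ℕ) (s : ℂ) :
    deriv (powDerivCoeff (r + 1)) s = deriv (powDerivCoeff r) s * (1 - s - r) - powDerivCoeff r s := by
  have h0 : powDerivCoeff (r + 1) = fun s => powDerivCoeff r s * (1 - s - r) := by
    ext s; exact powDerivCoeff_succ r s
  have h1 : HasDerivAt (fun s : ℂ => 1 - s - r) (-1) s := by
    simpa using ((hasDerivAt_id s).const_sub 1).sub_const (r : ℂ)
  rw [h0]
  refine (((differentiable_powDerivCoeff r s).hasDerivAt).mul h1).deriv.trans ?_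
  ring

/-- The function defining φ_{j,r} is ∂/∂s of t^(1-s)/(s-1) at s = -j. Exchanging the t- and
s-derivatives exhibits φ_{j,r} as the s-derivative of `powDerivCoeff r s / (s - 1)`, which is why
P_j occurs in ζ'(-j, y). -/
theorem phi_eq (j r : ℕ) : (phi j r : ℂ) =
    -(deriv (powDerivCoeff r) (-(j : ℂ)) / (j + 1) + powDerivCoeff r (-(j : ℂ)) / (j + 1) ^ 2) := by
  have hj : ((j : ℝ) + 1) ≠ 0 := by positivity
  have hjc : ((j : ℂ) + 1) ≠ 0 := by exact_mod_cast j.succ_ne_zero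
  -- Every derivative has the shape t^(j+1-r) (a log t + p), and p is its value at t = 1. The
  -- exponent is an integer power since r may exceed j+1.
  have key : ∀ r : ℕ, ∃ a p : ℝ, (a : ℂ) = powDerivCoeff r (-(j : ℂ)) / (j + 1) ∧
      (p : ℂ) = -(deriv (powDerivCoeff r) (-(j : ℂ)) / (j + 1)
        + powDerivCoeff r (-(j : ℂ)) / (j + 1) ^ 2) ∧
      ∀ t : ℝ, 0 < t → iteratedDeriv r (fun t : ℝ => t ^ (j + 1) / (j + 1) * Real.log t
        - t ^ (j + 1) / ((j : ℝ) + 1) ^ 2) t = t ^ ((j : ℤ) + 1 - r) * (a * Real.log t + p) := by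
    intro r
    induction r with
    | zero =>
      refine ⟨1 / (j + 1), -(1 / (j + 1) ^ 2), by simp [powDerivCoeff], ?_, fun t ht => ?_⟩
      · have : powDerivCoeff 0 = fun _ => 1 := by ext s; simp [powDerivCoeff]
        simp [this]
      · rw [iteratedDeriv_zero, show ((j : ℤ) + 1 - (0 : ℕ)) = ((j + 1 : ℕ) : ℤ) by simp,
          zpow_natCast]
        field_simp
        ring
    | succ r ih =>
      obtain ⟨a, p, ha, hp, h⟩ := ih
      refine ⟨((j : ℝ) + 1 - r) * a, ((j : ℝ) + 1 - r) * p + a, ?_, ?_, fun t ht => ?_⟩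
      · push_cast; rw [ha, powDerivCoeff_succ]; field_simp; ring
      · push_cast; rw [ha, hp, powDerivCoeff_succ, deriv_powDerivCoeff_succ]; field_simp; ring
      · rw [iteratedDeriv_succ]
        have he : iteratedDeriv r (fun t : ℝ => t ^ (j + 1) / (j + 1) * Real.log t
            - t ^ (j + 1) / ((j : ℝ) + 1) ^ 2) =ᶠ[𝓝 t]
            fun t => t ^ ((j : ℤ) + 1 - r) * (a * Real.log t + p) := by
          filter_upwards [lt_mem_nhds ht] with u hu using h u hu
        rw [he.deriv_eq]
        have h1 := (hasDerivAt_zpow ((j : ℤ) + 1 - r) t (Or.inl ht.ne')).mul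
          (((Real.hasDerivAt_log ht.ne').const_mul a).add_const p)
        refine h1.deriv.trans ?_
        rw [show ((j : ℤ) + 1 - (r + 1 : ℕ)) = (j : ℤ) + 1 - r - 1 by push_cast; ring,
          zpow_sub_one₀ ht.ne']
        push_cast
        field_simp
        ring
  obtain ⟨a, p, -, hp, h⟩ := key r
  rw [← hp, phi, h 1 one_pos]
  simp

/-- These are the undifferentiated correction terms at s = -j; they form the coefficient of the
logarithm in `zetaDerivApprox`. -/
theorem bernoulliPoly_succ_div (j : ℕ) (w : ℂ) : bernoulliPoly (j + 1) w / (j + 1) =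
    ∑ r ∈ Finset.range (j + 2), (bernoulli r : ℂ) / (r.factorial : ℂ) *
      (powDerivCoeff r (-(j : ℂ)) / (j + 1)) * w ^ (j + 1 - r) := by
  rw [bernoulliPoly, Polynomial.bernoulli, map_sum, Finset.sum_div]
  refine Finset.sum_congr rfl fun r _ => ?_
  rw [Polynomial.aeval_monomial, powDerivCoeff_neg_natCast,
    Nat.descFactorial_eq_factorial_mul_choose]
  have : (r.factorial : ℂ) ≠ 0 := by exact_mod_cast r.factorial_ne_zero
  push_cast
  simp
  field_simp

theorem hasDerivAt_zetaPartial (M N : ℕ) {y : ℝ} (hy : 0 < y) (s : ℂ) :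
    HasDerivAt (zetaPartial M N y)
      (∑ k ∈ Finset.range N, ((y + k : ℝ) : ℂ) ^ (-s)
        - (s - 1) * ∑ k ∈ Finset.range N,
          ((y + k : ℝ) : ℂ) ^ (-s) * (Real.log (y + k) : ℂ)
        + ∑ r ∈ Finset.range (M + 1), (bernoulli r : ℂ) / (r.factorial : ℂ) *
          ((deriv (powDerivCoeff r) s - powDerivCoeff r s * (Real.log (y + N) : ℂ)) *
            ((y + N : ℝ) : ℂ) ^ (1 - s - r))) s := by
  have h : ∀ k : ℕ, 0 < y + k := fun k => by positivity
  have h1 : ∀ (k : ℕ) (c : ℂ), HasDerivAt (fun s : ℂ => ((y + k : ℝ) : ℂ) ^ (c - s))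
      (-(((y + k : ℝ) : ℂ) ^ (c - s) * (Real.log (y + k) : ℂ))) s := by
    intro k c
    have h2 : HasDerivAt (fun s : ℂ => c - s) (-1) s := by
      simpa using (hasDerivAt_id s).const_sub c
    refine (h2.const_cpow (Or.inl (Complex.ofReal_ne_zero.mpr (h k).ne'))).congr_deriv ?_
    rw [Complex.ofReal_log (h k).le]; ring
  have h3 : HasDerivAt (fun s : ℂ => s - 1) 1 s := by
    simpa using (hasDerivAt_id s).sub_const 1
  have h4 : HasDerivAt (fun s : ℂ => ∑ k ∈ Finset.range N, ((y + k : ℝ) : ℂ) ^ (-s))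
      (∑ k ∈ Finset.range N, -(((y + k : ℝ) : ℂ) ^ (-s) * (Real.log (y + k) : ℂ))) s :=
    HasDerivAt.fun_sum fun k _ => by simpa using h1 k 0
  have h5 : HasDerivAt (fun s : ℂ => ∑ r ∈ Finset.range (M + 1),
      (bernoulli r : ℂ) / (r.factorial : ℂ) *
        (powDerivCoeff r s * ((y + N : ℝ) : ℂ) ^ (1 - s - r)))
      (∑ r ∈ Finset.range (M + 1), (bernoulli r : ℂ) / (r.factorial : ℂ) *
          ((deriv (powDerivCoeff r) s - powDerivCoeff r s * (Real.log (y + N) : ℂ)) *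
            ((y + N : ℝ) : ℂ) ^ (1 - s - r))) s := by
    refine HasDerivAt.fun_sum fun r _ => HasDerivAt.const_mul _ ?_
    have h6 := h1 N (1 - r)
    simp only [sub_right_comm (1 : ℂ) (r : ℂ)] at h6
    refine ((differentiable_powDerivCoeff r s).hasDerivAt.mul h6).congr_deriv ?_
    ring
  refine ((h3.mul h4).add h5).congr_deriv ?_
  rw [Finset.sum_neg_distrib]
  ring

/-- Truncated Euler–Maclaurin approximation to the derivative of the Hurwitz zeta function
`s ↦ ζ(s, y)` at `s = -j`. -/
noncomputable def zetaDerivApprox (j N : ℕ) (y : ℝ) : ℂ :=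
  bernoulliPoly (j + 1) ((y + N : ℝ) : ℂ) / (j + 1) * (Real.log (y + N) : ℂ) +
    P j ((y + N : ℝ) : ℂ) -
    ∑ k ∈ Finset.range N, ((y + k : ℝ) : ℂ) ^ j * (Real.log (y + k) : ℂ)

/-- If Z(s) = (s-1)ζ(s,y), then ζ' = -Z/(s-1)² + Z'/(s-1); the left side is this quotient rule at s
= -j for the partial sums. Taking M = j+2 puts -j inside the half-plane Re s > 3/2 - M. The price is
one correction term beyond P_j, with no logarithm because `powDerivCoeff (j + 2)` vanishes at -j,
and of order 1/(y+N). -/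
theorem zetaPartial_combination (j N : ℕ) {y : ℝ} (hy : 0 < y) :
    -((-(j : ℂ) - 1)⁻¹) ^ 2 * zetaPartial (j + 2) N y (-j) +
      (-(j : ℂ) - 1)⁻¹ * deriv (zetaPartial (j + 2) N y) (-j) =
    zetaDerivApprox j N y +
      (bernoulli (j + 2) : ℂ) / ((j + 2).factorial : ℂ) * phi j (j + 2) * ((y + N : ℝ) : ℂ)⁻¹ := by
  have hjc : ((j : ℂ) + 1) ≠ 0 := by exact_mod_cast j.succ_ne_zero
  have hjc' : (-(j : ℂ) - 1) ≠ 0 := by rw [← neg_add']; exact neg_ne_zero.mpr hjc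
  have hw : ((y + N : ℝ) : ℂ) ≠ 0 := by rw [Complex.ofReal_ne_zero]; positivity
  have hpow : ∀ r ∈ Finset.range (j + 2), ((y + N : ℝ) : ℂ) ^ (1 - (-(j : ℂ)) - r) =
      ((y + N : ℝ) : ℂ) ^ (j + 1 - r) := by
    intro r hr
    have hr' : r ≤ j + 1 := by simp at hr; omega
    rw [← Complex.cpow_natCast]; congr 1
    push_cast [Nat.cast_sub hr']; ring
  have hlast : ((y + N : ℝ) : ℂ) ^ (1 - (-(j : ℂ)) - (j + 2 : ℕ)) = ((y + N : ℝ) : ℂ)⁻¹ := by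
    rw [← Complex.cpow_neg_one]; congr 1; push_cast; ring
  have hB : bernoulliPoly (j + 1) ((y + N : ℝ) : ℂ) / (j + 1) * (Real.log (y + N) : ℂ) +
      P j ((y + N : ℝ) : ℂ) + (bernoulli (j + 2) : ℂ) / ((j + 2).factorial : ℂ) * phi j (j + 2) *
        ((y + N : ℝ) : ℂ)⁻¹ =
      -((-(j : ℂ) - 1)⁻¹) ^ 2 * (∑ r ∈ Finset.range (j + 2 + 1),
        (bernoulli r : ℂ) / (r.factorial : ℂ) *
          (powDerivCoeff r (-j) * ((y + N : ℝ) : ℂ) ^ (1 - (-(j : ℂ)) - r))) +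
      (-(j : ℂ) - 1)⁻¹ * (∑ r ∈ Finset.range (j + 2 + 1),
        (bernoulli r : ℂ) / (r.factorial : ℂ) *
          ((deriv (powDerivCoeff r) (-j) - powDerivCoeff r (-j) * (Real.log (y + N) : ℂ)) *
            ((y + N : ℝ) : ℂ) ^ (1 - (-(j : ℂ)) - r))) := by
    rw [Finset.sum_range_succ _ (j + 2), Finset.sum_range_succ _ (j + 2), hlast, powDerivCoeff_neg_natCast j (j + 2),
      Nat.descFactorial_of_lt (by omega : j + 1 < j + 2), bernoulliPoly_succ_div, P, phi_eq j (j + 2),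
      powDerivCoeff_neg_natCast j (j + 2), Nat.descFactorial_of_lt (by omega : j + 1 < j + 2),
      Finset.sum_mul, ← Finset.sum_add_distrib]
    rw [mul_add (-((-(j : ℂ) - 1)⁻¹) ^ 2), mul_add ((-(j : ℂ) - 1)⁻¹), add_add_add_comm,
      Finset.mul_sum, Finset.mul_sum, ← Finset.sum_add_distrib]
    congr 1
    · refine Finset.sum_congr rfl fun r hr => ?_
      rw [hpow r hr, phi_eq]
      rw [← neg_add' (j : ℂ) 1]
      field_simp
      ring
    · rw [← neg_add' (j : ℂ) 1]
      field_simp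
      simp
      ring
  have hk : ∀ k : ℕ, ((y + k : ℝ) : ℂ) ^ (-(-(j : ℂ))) = ((y + k : ℝ) : ℂ) ^ j := by
    intro k; rw [neg_neg, Complex.cpow_natCast]
  rw [(hasDerivAt_zetaPartial (j + 2) N hy _).deriv, zetaPartial, zetaDerivApprox]
  simp only [hk]
  have hi : (-(j : ℂ) - 1)⁻¹ * (-(j : ℂ) - 1) = 1 := inv_mul_cancel₀ hjc'
  generalize (-(j : ℂ) - 1)⁻¹ = q at *
  linear_combination
    (-q * (∑ k ∈ Finset.range N, ((y + k : ℝ) : ℂ) ^ j)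
      - ∑ k ∈ Finset.range N, ((y + k : ℝ) : ℂ) ^ j * (Real.log (y + k) : ℂ)) * hi - hB

/-- Locally uniform limits of holomorphic functions may be differentiated, so the quotient rule
passes to the limit while the surplus correction term tends to 0. -/
theorem tendsto_zetaDerivApprox_aux (j : ℕ) {y : ℝ} (hy : 0 < y) {f : ℂ → ℂ}
    (hf : TendstoLocallyUniformlyOn (fun N => zetaPartial (j + 2) N y) f atTop
      {s : ℂ | 3 / 2 - ((j + 2 : ℕ) : ℝ) < s.re}) :
    Tendsto (fun N => zetaDerivApprox j N y) atTop
      (𝓝 (-((-(j : ℂ) - 1)⁻¹) ^ 2 * f (-j) + (-(j : ℂ) - 1)⁻¹ * deriv f (-j))) := by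
  have hU : IsOpen {s : ℂ | 3 / 2 - ((j + 2 : ℕ) : ℝ) < s.re} :=
    isOpen_lt continuous_const Complex.continuous_re
  have hmem : (-(j : ℂ)) ∈ {s : ℂ | 3 / 2 - ((j + 2 : ℕ) : ℝ) < s.re} := by
    simp; linarith
  have h1 := hf.tendsto_at hmem
  have h2 := (hf.deriv (.of_forall fun N =>
    (differentiable_zetaPartial (j + 2) N hy).differentiableOn) hU).tendsto_at hmem
  have h3 := (h1.const_mul (-((-(j : ℂ) - 1)⁻¹) ^ 2)).add (h2.const_mul ((-(j : ℂ) - 1)⁻¹))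
  have h4 : Tendsto (fun N : ℕ => (bernoulli (j + 2) : ℂ) / ((j + 2).factorial : ℂ) *
      phi j (j + 2) * ((y + N : ℝ) : ℂ)⁻¹) atTop (𝓝 0) := by
    rw [show (0 : ℂ) = (bernoulli (j + 2) : ℂ) / ((j + 2).factorial : ℂ) *
      phi j (j + 2) * ((0 : ℝ) : ℂ) by simp]
    refine Tendsto.const_mul _ ?_
    simp only [← Complex.ofReal_inv]
    refine (Complex.continuous_ofReal.tendsto 0).comp ?_
    exact tendsto_inv_atTop_zero.comp
      (tendsto_atTop_add_const_left _ _ tendsto_natCast_atTop_atTop)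
  have h5 := h3.sub h4
  rw [sub_zero] at h5
  refine h5.congr fun N => ?_
  rw [sub_eq_iff_eq_add]
  exact zetaPartial_combination j N hy

theorem exists_tendsto_zetaDerivApprox (j : ℕ) {y : ℝ} (hy : 0 < y) :
    ∃ Z : ℂ, Tendsto (fun N => zetaDerivApprox j N y) atTop (𝓝 Z) :=
  ⟨_, tendsto_zetaDerivApprox_aux j hy
    (tendstoLocallyUniformlyOn_zetaPartial (j + 2) (by omega) hy)⟩

theorem tendsto_zetaDerivApprox_one (j : ℕ) :
    Tendsto (fun N => zetaDerivApprox j N 1) atTop (𝓝 (deriv riemannZeta (-(j : ℂ)))) := by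
  have h : (-(j : ℂ)) ≠ 1 := by
    rw [Ne, neg_eq_iff_eq_neg]; intro h
    have := congrArg Complex.re h
    simp at this
    linarith [Nat.cast_nonneg (α := ℝ) j]
  rw [deriv_riemannZeta_eq_neg_inv_sub_sq_mul_add h]
  exact tendsto_zetaDerivApprox_aux j one_pos
    ((tendstoLocallyUniformlyOn_zetaPartial (j + 2) (by omega) one_pos).congr_right
      (zetaPartial_limit_eqOn (j + 2) (by omega)))

/-! ### Truncated expansions of p(k) log(1 + z/k) at k = ∞. -/

/-- The nonnegative powers of `k` in the expansion of `p(k) log (1 + z / k)` at `k = ∞`. -/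
noncomputable def logPoly (z : ℂ) : ℂ[X] →ₗ[ℂ] ℂ[X] :=
  Polynomial.lsum fun r => LinearMap.toSpanSingleton ℂ ℂ[X]
    (∑ i ∈ Finset.range r, Polynomial.monomial (r - 1 - i) ((-1) ^ i * z ^ (i + 1) / (i + 1)))

/-- The coefficient of `1 / k` in the expansion of `p(k) log (1 + z / k)` at `k = ∞`. -/
noncomputable def logRes (z : ℂ) : ℂ[X] →ₗ[ℂ] ℂ :=
  Polynomial.lsum fun r => LinearMap.toSpanSingleton ℂ ℂ ((-1) ^ r * z ^ (r + 1) / (r + 1))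

/-- The terms of order at least `1 / k` in the expansion of `p(k) log (1 + z / k)`. -/
noncomputable def logTrunc (z : ℂ) (p : ℂ[X]) (k : ℂ) : ℂ :=
  (logPoly z p).eval k + logRes z p / k

theorem logPoly_monomial (z : ℂ) (r : ℕ) (c : ℂ) :
    logPoly z (Polynomial.monomial r c) = c • ∑ i ∈ Finset.range r,
      Polynomial.monomial (r - 1 - i) ((-1) ^ i * z ^ (i + 1) / (i + 1)) := by
  rw [logPoly, Polynomial.lsum_apply, Polynomial.sum_monomial_index _ _ (by simp)]
  simp

theorem logRes_monomial (z : ℂ) (r : ℕ) (c : ℂ) :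
    logRes z (Polynomial.monomial r c) = c * ((-1) ^ r * z ^ (r + 1) / (r + 1)) := by
  rw [logRes, Polynomial.lsum_apply, Polynomial.sum_monomial_index _ _ (by simp)]
  simp

theorem logTrunc_monomial (z : ℂ) (r : ℕ) (c : ℂ) {k : ℂ} (hk : k ≠ 0) :
    logTrunc z (Polynomial.monomial r c) k = c * (k ^ r * Complex.logTaylor (r + 2) (z / k)) := by
  rw [logTrunc, logPoly_monomial, logRes_monomial, Complex.logTaylor, Finset.sum_range_succ',
    Finset.sum_range_succ, Polynomial.eval_smul, Polynomial.eval_finsetSum, smul_eq_mul,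
    mul_div_assoc, ← mul_add]
  congr 1
  simp only [Polynomial.eval_monomial, Nat.cast_zero, div_zero, add_zero, mul_add, Finset.mul_sum]
  congr 1
  · refine Finset.sum_congr rfl fun i hi => ?_
    have hir : r = (r - 1 - i) + (i + 1) := by have := Finset.mem_range.mp hi; omega
    have : (i + 1 : ℂ) ≠ 0 := by exact_mod_cast i.succ_ne_zero
    conv_rhs => rw [hir]
    rw [pow_add k, div_pow]
    push_cast
    field_simp
    ring
  · have : (r + 1 : ℂ) ≠ 0 := by exact_mod_cast r.succ_ne_zero
    rw [div_pow]
    push_cast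
    field_simp
    ring

/-- By linearity p is a monomial of degree r. For |z/k| ≤ 1/2 the Taylor remainder of the logarithm
past degree r+1 is at most 2|z/k|^(r+2), and the factor k^r leaves k⁻². -/
theorem norm_eval_mul_log_sub_logTrunc_le (p : ℂ[X]) {R : ℝ} (hR : 0 ≤ R) :
    ∃ C : ℝ, ∀ (k : ℝ) (z : ℂ), 0 < k → 2 * R ≤ k → ‖z‖ ≤ R →
      ‖p.eval (k : ℂ) * Complex.log (1 + z / k) - logTrunc z p k‖ ≤ C / k ^ 2 := by
  induction p using Polynomial.induction_on' with
  | add p q hp hq =>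
    obtain ⟨C, hC⟩ := hp
    obtain ⟨D, hD⟩ := hq
    refine ⟨C + D, fun k z hk hk2 hz => ?_⟩
    have : (p + q).eval (k : ℂ) * Complex.log (1 + z / k) - logTrunc z (p + q) k =
        (p.eval (k : ℂ) * Complex.log (1 + z / k) - logTrunc z p k) +
        (q.eval (k : ℂ) * Complex.log (1 + z / k) - logTrunc z q k) := by
      simp only [logTrunc, map_add, Polynomial.eval_add]; ring
    rw [this, add_div]
    exact (norm_add_le _ _).trans (add_le_add (hC k z hk hk2 hz) (hD k z hk hk2 hz))
  | monomial r c =>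
    refine ⟨‖c‖ * (2 * R ^ (r + 2)), fun k z hk hk2 hz => ?_⟩
    have hkc : (k : ℂ) ≠ 0 := Complex.ofReal_ne_zero.mpr hk.ne'
    have hn : ‖z / k‖ = ‖z‖ / k := by rw [norm_div, Complex.norm_real, Real.norm_of_nonneg hk.le]
    have hzk : ‖z‖ / k ≤ 1 / 2 := by rw [div_le_div_iff₀ hk two_pos]; linarith
    have h1 := Complex.norm_log_sub_logTaylor_le (r + 1) (z := z / k) (by rw [hn]; linarith)
    rw [logTrunc_monomial z r c hkc, Polynomial.eval_monomial, mul_assoc, ← mul_sub, ← mul_sub,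
      norm_mul, norm_mul, mul_div_assoc]
    gcongr
    rw [norm_pow, Complex.norm_real, Real.norm_of_nonneg hk.le]
    have h2 : ‖Complex.log (1 + z / k) - Complex.logTaylor (r + 2) (z / k)‖ ≤
        (R / k) ^ (r + 2) * 2 := by
      refine h1.trans ?_
      rw [hn]
      have h3 : (1 - ‖z‖ / k)⁻¹ ≤ 2 := by
        rw [inv_le_comm₀ (by linarith) two_pos]; linarith
      have h4 : (1 : ℝ) ≤ ((r + 1 : ℕ) : ℝ) + 1 := by simp; positivity
      refine (div_le_self (by have : 0 ≤ (1 - ‖z‖ / k)⁻¹ := inv_nonneg.mpr (by linarith)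
                              positivity) h4).trans ?_
      have h5 : (‖z‖ / k) ^ (r + 1 + 1) ≤ (R / k) ^ (r + 2) := by gcongr
      exact mul_le_mul h5 h3 (inv_nonneg.mpr (by linarith)) (by positivity)
    calc k ^ r * ‖Complex.log (1 + z / k) - Complex.logTaylor (r + 2) (z / k)‖
        ≤ k ^ r * ((R / k) ^ (r + 2) * 2) := by gcongr
      _ = 2 * R ^ (r + 2) / k ^ 2 := by rw [div_pow]; field_simp; ring

/-! ### Polynomial functions with degree bounds; Bernoulli polynomials. -/

/-- `f` is a polynomial function of degree at most `d`. -/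
def IsPolyLE (d : ℕ) (f : ℂ → ℂ) : Prop := ∃ p : ℂ[X], p.natDegree ≤ d ∧ ∀ z, f z = p.eval z

namespace IsPolyLE

theorem eval (p : ℂ[X]) : IsPolyLE p.natDegree (fun z => p.eval z) := ⟨p, le_rfl, fun _ => rfl⟩

theorem mono {d e : ℕ} {f : ℂ → ℂ} (h : IsPolyLE d f) (hde : d ≤ e) : IsPolyLE e f := by
  obtain ⟨p, hp, h⟩ := h; exact ⟨p, hp.trans hde, h⟩

theorem const (c : ℂ) : IsPolyLE 0 (fun _ => c) := ⟨Polynomial.C c, by simp, by simp⟩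

theorem pow_id (d : ℕ) : IsPolyLE d (fun z => z ^ d) := ⟨Polynomial.X ^ d, by simp, by simp⟩

theorem add {d : ℕ} {f g : ℂ → ℂ} (hf : IsPolyLE d f) (hg : IsPolyLE d g) :
    IsPolyLE d (fun z => f z + g z) := by
  obtain ⟨p, hp, hf⟩ := hf; obtain ⟨q, hq, hg⟩ := hg
  exact ⟨p + q, Polynomial.natDegree_add_le_of_degree_le hp hq, by simp [hf, hg]⟩

theorem mul {d e : ℕ} {f g : ℂ → ℂ} (hf : IsPolyLE d f) (hg : IsPolyLE e g) :
    IsPolyLE (d + e) (fun z => f z * g z) := by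
  obtain ⟨p, hp, hf⟩ := hf; obtain ⟨q, hq, hg⟩ := hg
  exact ⟨p * q, Polynomial.natDegree_mul_le_of_le hp hq, by simp [hf, hg]⟩

theorem const_mul {d : ℕ} {f : ℂ → ℂ} (hf : IsPolyLE d f) (c : ℂ) :
    IsPolyLE d (fun z => c * f z) := ((const c).mul hf).mono (by simp)

theorem mul_const {d : ℕ} {f : ℂ → ℂ} (hf : IsPolyLE d f) (c : ℂ) :
    IsPolyLE d (fun z => f z * c) := hf.mul (const c)

theorem sub {d : ℕ} {f g : ℂ → ℂ} (hf : IsPolyLE d f) (hg : IsPolyLE d g) :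
    IsPolyLE d (fun z => f z - g z) := by
  simpa [sub_eq_add_neg] using hf.add (hg.const_mul (-1))

theorem sum {ι : Type*} {d : ℕ} {s : Finset ι} {f : ι → ℂ → ℂ} (h : ∀ i ∈ s, IsPolyLE d (f i)) :
    IsPolyLE d (fun z => ∑ i ∈ s, f i z) := by
  classical
  induction s using Finset.induction_on with
  | empty => simpa using (const 0).mono (Nat.zero_le d)
  | insert a s ha ih =>
    simp only [Finset.sum_insert ha]
    exact (h a (by simp)).add (ih fun i hi => h i (by simp [hi]))

theorem comp_add_const {d : ℕ} {f : ℂ → ℂ} (hf : IsPolyLE d f) (c : ℂ) :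
    IsPolyLE d (fun z => f (z + c)) := by
  obtain ⟨p, hp, hf⟩ := hf
  exact ⟨p.comp (Polynomial.X + Polynomial.C c), by rwa [Polynomial.natDegree_comp,
    Polynomial.natDegree_X_add_C, mul_one], by simp [hf]⟩

/-- A nonconstant polynomial is unbounded along the integers. This yields a polynomial identity from
a limit alone, without comparing coefficients. -/
theorem eq_zero_of_tendsto {d : ℕ} {f : ℂ → ℂ} (hf : IsPolyLE d f)
    (h : Tendsto (fun N : ℕ => f ((N : ℂ) + 1)) atTop (𝓝 0)) (z : ℂ) : f z = 0 := by
  obtain ⟨p, -, hf⟩ := hf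
  have h1 : Tendsto (fun N : ℕ => ‖(N : ℂ) + 1‖) atTop atTop := by
    have : (fun N : ℕ => ‖(N : ℂ) + 1‖) = fun N : ℕ => (N : ℝ) + 1 := by
      ext N
      have := Complex.norm_natCast (N + 1)
      push_cast at this; exact this
    rw [this]
    exact tendsto_atTop_add_const_right _ _ tendsto_natCast_atTop_atTop
  have h2 : Tendsto (fun N : ℕ => ‖p.eval ((N : ℂ) + 1)‖) atTop (𝓝 0) := by
    simpa [hf] using h.norm
  have h3 : ¬ 0 < p.degree := fun hd =>
    not_tendsto_nhds_of_tendsto_atTop (p.tendsto_norm_atTop hd h1) 0 h2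
  rw [Polynomial.eq_C_of_degree_le_zero (not_lt.mp h3)] at hf
  have h4 : p.coeff 0 = 0 := by
    have := tendsto_nhds_unique h (tendsto_const_nhds (x := p.coeff 0) |>.congr (by simp [hf]))
    exact this.symm
  simp [hf, h4]

end IsPolyLE

theorem iterate_derivative_bernoulli (n k : ℕ) :
    Polynomial.derivative^[k] (Polynomial.bernoulli n) =
      (n.descFactorial k : ℚ[X]) * Polynomial.bernoulli (n - k) := by
  induction k with
  | zero => simp
  | succ k ih =>
    rw [Function.iterate_succ_apply', ih, Polynomial.derivative_natCast_mul,
      Polynomial.derivative_bernoulli, Nat.descFactorial_succ, Nat.sub_sub]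
    push_cast; ring

theorem natDegree_bernoulli_le (n : ℕ) : (Polynomial.bernoulli n).natDegree ≤ n := by
  rw [Polynomial.bernoulli]
  refine Polynomial.natDegree_sum_le_of_forall_le _ _ fun i _ => ?_
  exact (Polynomial.natDegree_monomial_le _).trans (Nat.sub_le _ _)

theorem isPolyLE_bernoulliPoly (n : ℕ) : IsPolyLE n (bernoulliPoly n) :=
  ⟨(Polynomial.bernoulli n).map (algebraMap ℚ ℂ),
    Polynomial.natDegree_map_le.trans (natDegree_bernoulli_le n),
    fun z => by rw [bernoulliPoly, Polynomial.eval_map_algebraMap]⟩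

/-- Taylor expansion about x: the r-th derivative of B_n is n(n-1)⋯(n-r+1) B_{n-r}. -/
theorem bernoulliPoly_add (n : ℕ) (x w : ℂ) : bernoulliPoly n (x + w) =
    ∑ r ∈ Finset.range (n + 1), (n.choose r : ℂ) * bernoulliPoly (n - r) x * w ^ r := by
  have h1 : bernoulliPoly n (x + w) = (Polynomial.taylor x
      ((Polynomial.bernoulli n).map (algebraMap ℚ ℂ))).eval w := by
    rw [Polynomial.taylor_eval, Polynomial.eval_map_algebraMap, bernoulliPoly, add_comm]
  rw [h1, Polynomial.eval_eq_sum_range' (n := n + 1)]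
  · refine Finset.sum_congr rfl fun r _ => ?_
    congr 1
    rw [Polynomial.taylor_coeff]
    have h2 : (r.factorial : ℂ) * (Polynomial.hasseDeriv r
        ((Polynomial.bernoulli n).map (algebraMap ℚ ℂ))).eval x =
        r.factorial * ((n.choose r : ℂ) * bernoulliPoly (n - r) x) := by
      have h3 := congrArg (fun f => f ((Polynomial.bernoulli n).map (algebraMap ℚ ℂ)))
        (Polynomial.factorial_smul_hasseDeriv (R := ℂ) r)
      simp only [LinearMap.smul_apply] at h3
      have h4 := congrArg (Polynomial.eval x) h3
      rw [Polynomial.iterate_derivative_map, iterate_derivative_bernoulli,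
        Polynomial.eval_smul] at h4
      simp only [nsmul_eq_mul] at h4
      rw [h4, Nat.descFactorial_eq_factorial_mul_choose, bernoulliPoly]
      simp [mul_assoc]
    exact mul_left_cancel₀ (by exact_mod_cast r.factorial_ne_zero) h2
  · rw [Polynomial.natDegree_taylor]
    exact Nat.lt_succ_of_le (Polynomial.natDegree_map_le.trans (natDegree_bernoulli_le n))

theorem isPolyLE_P (j : ℕ) : IsPolyLE (j + 1) (P j) := by
  unfold P
  refine IsPolyLE.sum fun r _ => IsPolyLE.const_mul ?_ _
  exact (IsPolyLE.pow_id _).mono (Nat.sub_le _ _)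

/-- The precise degree matters: it makes F of degree at most m+1, hence annihilated by m+2
derivatives. -/
theorem isPolyLE_Q (j : ℕ) : IsPolyLE (j + 1) (Q j) := by
  unfold Q
  refine (((isPolyLE_P j).comp_add_const 1).sub (IsPolyLE.sum fun r hr => ?_)).add
    (IsPolyLE.const_mul (IsPolyLE.sum fun r hr => ?_) _)
  · refine IsPolyLE.mul_const (((IsPolyLE.pow_id r).const_mul _).mono ?_) _
    have := Finset.mem_range.mp hr; omega
  · rw [Finset.mem_Icc] at hr
    refine ((((isPolyLE_bernoulliPoly (j + 1 - r)).const_mul _).mul (e := r)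
      (IsPolyLE.sum fun l hl => ?_))).mono (by omega)
    rw [Finset.mem_Icc] at hl
    simp only [div_eq_mul_inv]
    exact (((IsPolyLE.pow_id l).const_mul _).mul_const _).mono hl.2

theorem C_add_X_pow (x : ℂ) (j : ℕ) : (Polynomial.C x + Polynomial.X : ℂ[X]) ^ j =
    ∑ r ∈ Finset.range (j + 1), Polynomial.monomial r ((j.choose r : ℂ) * x ^ (j - r)) := by
  rw [add_comm, add_pow]
  refine Finset.sum_congr rfl fun r _ => ?_
  rw [← Polynomial.C_mul_X_pow_eq_monomial]
  simp only [map_mul, map_pow, map_natCast]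
  ring

theorem choose_div_succ (j r : ℕ) :
    (j.choose r : ℂ) / (r + 1) = ((j + 1).choose (r + 1) : ℂ) / (j + 1) := by
  have h1 : (r + 1 : ℂ) ≠ 0 := by exact_mod_cast r.succ_ne_zero
  have h2 : (j + 1 : ℂ) ≠ 0 := by exact_mod_cast j.succ_ne_zero
  have h3 := Nat.add_one_mul_choose_eq j r
  rw [div_eq_div_iff h1 h2]
  have h4 : ((j + 1 : ℕ) : ℂ) * j.choose r = (j + 1).choose (r + 1) * (r + 1 : ℕ) := by
    exact_mod_cast h3
  push_cast at h4
  linear_combination h4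

/-- The alternating sum of the binomial coefficients of j+1 vanishes. The result is the coefficient
of the harmonic numbers, hence later of γ. -/
theorem logRes_C_add_X_pow (x : ℂ) (j : ℕ) :
    logRes x ((Polynomial.C x + Polynomial.X : ℂ[X]) ^ j) = x ^ (j + 1) / (j + 1) := by
  rw [C_add_X_pow, map_sum]
  simp only [logRes_monomial]
  have h1 : ∀ r ∈ Finset.range (j + 1), (j.choose r : ℂ) * x ^ (j - r) *
      ((-1) ^ r * x ^ (r + 1) / (r + 1)) =
      -(x ^ (j + 1) / (j + 1)) * ((-1) ^ (r + 1) * (j + 1).choose (r + 1)) := by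
    intro r hr
    have hx : x ^ (j + 1) = x ^ (j - r) * x ^ (r + 1) := by
      rw [← pow_add]; congr 1; have := Finset.mem_range.mp hr; omega
    rw [hx]
    have := choose_div_succ j r
    rw [div_eq_mul_inv] at this
    rw [pow_succ (-1 : ℂ) r]
    linear_combination (x ^ (j - r) * x ^ (r + 1) * (-1) ^ r) * this
  rw [Finset.sum_congr rfl h1, ← Finset.mul_sum]
  have h2 := Int.alternating_sum_range_choose_of_ne (n := j + 1) (by omega)
  rw [Finset.sum_range_succ'] at h2
  have h3 : ∑ r ∈ Finset.range (j + 1), ((-1 : ℂ) ^ (r + 1) * ((j + 1).choose (r + 1) : ℂ)) = -1 := by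
    have := congrArg (Int.cast : ℤ → ℂ) h2
    push_cast at this
    simp at this
    linear_combination this
  rw [h3]; ring

theorem norm_log_term_le (p : ℂ[X]) {R : ℝ} (hR : 0 ≤ R) :
    ∃ C : ℝ, ∀ᶠ k : ℕ in atTop, ∀ z : ℂ, ‖z‖ ≤ R →
      ‖p.eval ((k : ℂ) + 1) * Complex.log (1 + z / ((k : ℂ) + 1)) - logTrunc z p ((k : ℂ) + 1)‖ ≤
        C * (1 / (k : ℝ) ^ 2) := by
  obtain ⟨C, hC⟩ := norm_eval_mul_log_sub_logTrunc_le p hR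
  refine ⟨|C|, ?_⟩
  -- k ≥ 1 is required since the majorant 1/k² takes the default value 0 at k = 0; k ≥ 2R puts
  -- z/(k+1) in the disc of radius 1/2.
  filter_upwards [eventually_ge_atTop (max 1 ⌈2 * R⌉₊)] with k hk z hz
  have hk1 : (1 : ℝ) ≤ k := by exact_mod_cast (le_max_left _ _).trans hk
  have hk2 : 2 * R ≤ k := (Nat.le_ceil _).trans (by exact_mod_cast (le_max_right _ _).trans hk)
  have := hC (k + 1) z (by positivity) (by linarith) hz
  push_cast at this
  refine this.trans ?_
  rw [mul_one_div]
  have : |C| / ((k : ℝ) + 1) ^ 2 ≤ |C| / (k : ℝ) ^ 2 := by gcongr; linarith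
  refine le_trans ?_ this
  gcongr
  exact le_abs_self C

theorem summable_log_term (p : ℂ[X]) (z : ℂ) :
    Summable fun k : ℕ => p.eval ((k : ℂ) + 1) * Complex.log (1 + z / ((k : ℂ) + 1))
      - logTrunc z p ((k : ℂ) + 1) := by
  obtain ⟨C, hC⟩ := norm_log_term_le p (norm_nonneg z)
  refine Summable.of_norm_bounded_eventually_nat
    (g := fun k : ℕ => C * (1 / (k : ℝ) ^ 2))
    ((Real.summable_one_div_nat_pow.mpr one_lt_two).mul_left C) ?_
  filter_upwards [hC] with k hk using hk z le_rfl

/-- This balances the logarithms of the cutoff: after the ζ'(-r) parts are removed, log(N+1) keeps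
only the coefficient x^(j+1)/(j+1), the same as that of the harmonic number. -/
theorem bernoulliPoly_add_div (j : ℕ) (x w : ℂ) :
    bernoulliPoly (j + 1) (x + w) / (j + 1) = x ^ (j + 1) / (j + 1) +
      ∑ r ∈ Finset.range (j + 1), (j.choose r : ℂ) * x ^ (j - r) *
        (bernoulliPoly (r + 1) w / (r + 1)) := by
  rw [add_comm x, bernoulliPoly_add]
  rw [← Finset.sum_flip (fun r => ((j + 1).choose r : ℂ) * bernoulliPoly (j + 1 - r) w * x ^ r)]
  rw [Finset.sum_range_succ', add_div, Finset.sum_div, add_comm]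
  congr 1
  · simp [bernoulliPoly]
  · refine Finset.sum_congr rfl fun r hr => ?_
    have hr' : r + 1 ≤ j + 1 := by have := Finset.mem_range.mp hr; omega
    rw [Nat.choose_symm hr', Nat.sub_sub_self hr', Nat.add_sub_add_right]
    have := choose_div_succ j r
    rw [div_eq_mul_inv, div_eq_mul_inv] at this
    linear_combination (-(x ^ (j - r) * bernoulliPoly (r + 1) w)) * this

/-! ### The expansion of ζ'(-j, x+1) and the origin of Q_j. -/

/-- `k ↦ B_{j+1}(x + k) / (j + 1)` as a polynomial in `k`. -/
noncomputable def bernoulliShift (j : ℕ) (x : ℂ) : ℂ[X] :=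
  ∑ r ∈ Finset.range (j + 2), Polynomial.monomial r
    (((j + 1).choose r : ℂ) * bernoulliPoly (j + 1 - r) x / (j + 1))

theorem eval_bernoulliShift (j : ℕ) (x w : ℂ) :
    (bernoulliShift j x).eval w = bernoulliPoly (j + 1) (x + w) / (j + 1) := by
  rw [bernoulliPoly_add, bernoulliShift, Polynomial.eval_finsetSum, Finset.sum_div]
  refine Finset.sum_congr rfl fun r _ => ?_
  rw [Polynomial.eval_monomial]; ring

/-- The polynomial in `m` whose value at `m = 1` is `Q j x`. -/
noncomputable def shiftedQ (j : ℕ) (x m : ℂ) : ℂ :=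
  (logPoly x (bernoulliShift j x)).eval m + P j (x + m) -
    ∑ r ∈ Finset.range (j + 1), (j.choose r : ℂ) * x ^ (j - r) * P r m

theorem shiftedQ_one (j : ℕ) (x : ℂ) : shiftedQ j x 1 = Q j x := by
  rw [shiftedQ, Q]
  have h1 : ∑ r ∈ Finset.range (j + 1), (j.choose r : ℂ) * x ^ (j - r) * P r 1 =
      ∑ r ∈ Finset.range (j + 1), (j.choose r : ℂ) * x ^ r * P (j - r) 1 := by
    rw [← Finset.sum_flip]
    refine Finset.sum_congr rfl fun r hr => ?_
    have hr' : r ≤ j := by have := Finset.mem_range.mp hr; omega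
    rw [Nat.choose_symm hr', Nat.sub_sub_self hr']
  have h2 : (logPoly x (bernoulliShift j x)).eval 1 =
      1 / ((j : ℂ) + 1) * ∑ r ∈ Finset.Icc 1 (j + 1),
        ((j + 1).choose r : ℂ) * bernoulliPoly (j + 1 - r) x *
          ∑ l ∈ Finset.Icc 1 r, (-1 : ℂ) ^ (l - 1) * x ^ l / (l : ℂ) := by
    rw [bernoulliShift, map_sum, Polynomial.eval_finsetSum, Finset.sum_range_succ', Finset.mul_sum,
      ← Finset.Ico_succ_right_eq_Icc, Finset.sum_Ico_eq_sum_range]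
    simp only [logPoly_monomial, Finset.range_zero, Finset.sum_empty, smul_zero,
      Polynomial.eval_zero, add_zero]
    refine Finset.sum_congr rfl fun r _ => ?_
    rw [Polynomial.eval_smul, Polynomial.eval_finsetSum, ← Finset.Ico_succ_right_eq_Icc,
      Finset.sum_Ico_eq_sum_range, add_comm 1 r, smul_eq_mul]
    simp only [Polynomial.eval_monomial, one_pow, mul_one]
    have h3 : ∀ i : ℕ, (-1 : ℂ) ^ (1 + i - 1) * x ^ (1 + i) / ((1 + i : ℕ) : ℂ) =
        (-1) ^ i * x ^ (i + 1) / (i + 1) := by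
      intro i; rw [Nat.add_sub_cancel_left, add_comm 1 i]; push_cast; rfl
    simp only [h3]
    simp
    ring
  rw [h1, h2]; ring

theorem ofReal_log_add {x k : ℝ} (hk : 0 < k) (hx : 0 < x + k) :
    (Real.log (x + k) : ℂ) = Real.log k + Complex.log (1 + (x : ℂ) / (k : ℂ)) := by
  have h1 : 0 < 1 + x / k := by
    have : 1 + x / k = (x + k) / k := by field_simp; ring
    rw [this]; positivity
  have h2 : (1 + (x : ℂ) / (k : ℂ)) = ((1 + x / k : ℝ) : ℂ) := by push_cast; rfl
  rw [h2, ← Complex.ofReal_log h1.le, ← Complex.ofReal_add, ← Real.log_mul hk.ne' h1.ne']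
  congr 2
  field_simp
  ring

/-- Each log(x+1+k) is split as log(k+1) + log(1 + x/(k+1)), including the boundary case k = N. The
four groups on the right are the γ part, the convergent series, a boundary term tending to 0, and a
remainder free of logarithms. -/
theorem zetaDerivApprox_sub (j N : ℕ) {x : ℝ} (hx : -1 < x) :
    zetaDerivApprox j N (x + 1) -
      ∑ r ∈ Finset.range (j + 1), (j.choose r : ℂ) * (x : ℂ) ^ (j - r) * zetaDerivApprox r N 1 =
    (x : ℂ) ^ (j + 1) / (j + 1) * ((Real.log (N + 1) - harmonic N : ℝ) : ℂ) -
    ∑ k ∈ Finset.range N, (((Polynomial.C (x : ℂ) + Polynomial.X : ℂ[X]) ^ j).eval ((k : ℂ) + 1) *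
      Complex.log (1 + x / ((k : ℂ) + 1)) -
      logTrunc x ((Polynomial.C (x : ℂ) + Polynomial.X : ℂ[X]) ^ j) ((k : ℂ) + 1)) +
    ((bernoulliShift j x).eval ((N : ℂ) + 1) * Complex.log (1 + x / ((N : ℂ) + 1)) -
      (logPoly x (bernoulliShift j x)).eval ((N : ℂ) + 1)) +
    (shiftedQ j x ((N : ℂ) + 1) - ∑ k ∈ Finset.range N,
      (logPoly x ((Polynomial.C (x : ℂ) + Polynomial.X : ℂ[X]) ^ j)).eval ((k : ℂ) + 1)) := by
  have hlog : ∀ k : ℕ, (Real.log (x + 1 + k) : ℂ) =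
      Real.log ((k : ℝ) + 1) + Complex.log (1 + (x : ℂ) / ((k : ℂ) + 1)) := by
    intro k
    have := ofReal_log_add (x := x) (k := (k : ℝ) + 1) (by positivity)
      (by have : (0 : ℝ) ≤ k := k.cast_nonneg
          linarith)
    push_cast at this
    rw [show x + 1 + (k : ℝ) = x + (k + 1) by ring]
    exact this
  have hcast : ∀ k : ℕ, ((x + 1 + k : ℝ) : ℂ) = x + ((k : ℂ) + 1) := by intro k; push_cast; ring
  have hcast1 : ∀ k : ℕ, ((1 + k : ℝ) : ℂ) = (k : ℂ) + 1 := by intro k; push_cast; ring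
  have hlog1 : ∀ k : ℕ, (Real.log (1 + k) : ℂ) = Real.log ((k : ℝ) + 1) := by
    intro k; rw [add_comm]
  have hharm : ((harmonic N : ℝ) : ℂ) = ∑ k ∈ Finset.range N, ((k : ℂ) + 1)⁻¹ := by
    rw [harmonic]; push_cast; rfl
  have hpow : ∀ k : ℕ, ((x : ℂ) + ((k : ℂ) + 1)) ^ j =
      ∑ r ∈ Finset.range (j + 1), (j.choose r : ℂ) * (x : ℂ) ^ (j - r) * ((k : ℂ) + 1) ^ r := by
    intro k
    rw [add_comm, add_pow]
    exact Finset.sum_congr rfl fun r _ => by ring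
  simp only [zetaDerivApprox, hlog, hlog1, hcast, hcast1, shiftedQ, eval_bernoulliShift, logTrunc,
    logRes_C_add_X_pow, Polynomial.eval_pow, Polynomial.eval_add, Polynomial.eval_C,
    Polynomial.eval_X, mul_add, Finset.sum_add_distrib, Finset.sum_sub_distrib]
  have h1 : ∑ k ∈ Finset.range N, (x : ℂ) ^ (j + 1) / (j + 1) / ((k : ℂ) + 1) =
      (x : ℂ) ^ (j + 1) / (j + 1) * (harmonic N : ℝ) := by
    rw [hharm, Finset.mul_sum]; rfl
  have h2 : ∑ k ∈ Finset.range N, ((x : ℂ) + ((k : ℂ) + 1)) ^ j * (Real.log ((k : ℝ) + 1) : ℂ) =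
      ∑ r ∈ Finset.range (j + 1), (j.choose r : ℂ) * (x : ℂ) ^ (j - r) *
        ∑ k ∈ Finset.range N, ((k : ℂ) + 1) ^ r * (Real.log ((k : ℝ) + 1) : ℂ) := by
    simp only [hpow, Finset.sum_mul, Finset.mul_sum]
    rw [Finset.sum_comm]
    exact Finset.sum_congr rfl fun r _ => Finset.sum_congr rfl fun k _ => by ring
  have h3 := bernoulliPoly_add_div j (x : ℂ) ((N : ℂ) + 1)
  have h4 : ∑ r ∈ Finset.range (j + 1), (j.choose r : ℂ) * (x : ℂ) ^ (j - r) *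
      (bernoulliPoly (r + 1) ((N : ℂ) + 1) / (r + 1) * (Real.log ((N : ℝ) + 1) : ℂ)) =
      (∑ r ∈ Finset.range (j + 1), (j.choose r : ℂ) * (x : ℂ) ^ (j - r) *
        (bernoulliPoly (r + 1) ((N : ℂ) + 1) / (r + 1))) * (Real.log ((N : ℝ) + 1) : ℂ) := by
    rw [Finset.sum_mul]
    exact Finset.sum_congr rfl fun r _ => by ring
  simp only [mul_sub, Finset.sum_sub_distrib, mul_add, Finset.sum_add_distrib, h1, h2, h4]
  push_cast
  linear_combination (Real.log ((N : ℝ) + 1) : ℂ) * h3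

/-- The limit exists by Euler–Maclaurin and the first three groups of `zetaDerivApprox_sub`
converge, so the last one converges too; being of polynomial type in N it must be constant. -/
theorem tendsto_zetaDerivApprox (j : ℕ) {x : ℝ} (hx : -1 < x) :
    Tendsto (fun N => zetaDerivApprox j N (x + 1)) atTop
      (𝓝 (Q j x + ∑ r ∈ Finset.range (j + 1), (j.choose r : ℂ) * (x : ℂ) ^ (j - r) *
          deriv riemannZeta (-(r : ℂ)) - Real.eulerMascheroniConstant * ((x : ℂ) ^ (j + 1) / (j + 1)) -
        ∑' k : ℕ, (((Polynomial.C (x : ℂ) + Polynomial.X : ℂ[X]) ^ j).eval ((k : ℂ) + 1) *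
          Complex.log (1 + x / ((k : ℂ) + 1)) -
          logTrunc x ((Polynomial.C (x : ℂ) + Polynomial.X : ℂ[X]) ^ j) ((k : ℂ) + 1)))) := by
  obtain ⟨Z, hZ⟩ := exists_tendsto_zetaDerivApprox j (y := x + 1) (by linarith)
  have hS := (summable_log_term ((Polynomial.C (x : ℂ) + Polynomial.X : ℂ[X]) ^ j)
    x).hasSum.tendsto_sum_nat
  have hζ : Tendsto (fun N => ∑ r ∈ Finset.range (j + 1),
      (j.choose r : ℂ) * (x : ℂ) ^ (j - r) * zetaDerivApprox r N 1) atTop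
      (𝓝 (∑ r ∈ Finset.range (j + 1), (j.choose r : ℂ) * (x : ℂ) ^ (j - r) *
          deriv riemannZeta (-(r : ℂ)))) :=
    tendsto_finsetSum _ fun r _ => (tendsto_zetaDerivApprox_one r).const_mul _
  have hγ : Tendsto (fun N : ℕ => (x : ℂ) ^ (j + 1) / (j + 1) *
      ((Real.log (N + 1) - harmonic N : ℝ) : ℂ)) atTop
      (𝓝 ((x : ℂ) ^ (j + 1) / (j + 1) * ((-Real.eulerMascheroniConstant : ℝ) : ℂ))) := by
    refine Tendsto.const_mul _ ((Complex.continuous_ofReal.tendsto _).comp ?_)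
    have := Real.tendsto_harmonic_sub_log_add_one.neg
    simpa using this
  have hB : Tendsto (fun N : ℕ => (bernoulliShift j x).eval ((N : ℂ) + 1) *
      Complex.log (1 + x / ((N : ℂ) + 1)) -
      (logPoly x (bernoulliShift j x)).eval ((N : ℂ) + 1)) atTop (𝓝 0) := by
    have h1 := (summable_log_term (bernoulliShift j x) x).tendsto_atTop_zero
    have h2 : Tendsto (fun N : ℕ => logRes x (bernoulliShift j x) / ((N : ℂ) + 1)) atTop (𝓝 0) := by
      have := (tendsto_one_div_add_atTop_nhds_zero_nat (𝕜 := ℂ)).const_mul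
        (logRes x (bernoulliShift j x))
      simpa only [mul_one_div, mul_zero] using this
    have h3 := h1.add h2
    rw [add_zero] at h3
    refine h3.congr fun N => ?_
    rw [logTrunc]; ring
  set p : ℕ → ℂ := fun N => shiftedQ j x ((N : ℂ) + 1) - ∑ k ∈ Finset.range N,
      (logPoly x ((Polynomial.C (x : ℂ) + Polynomial.X : ℂ[X]) ^ j)).eval ((k : ℂ) + 1) with hp
  have hpl := (((hZ.sub hζ).sub hγ).add hS).sub hB
  have hpl' : Tendsto p atTop (𝓝 _) := hpl.congr fun N => by
    rw [zetaDerivApprox_sub j N hx]; ring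
  -- The increment of p is a polynomial evaluated at N+1, and it tends to 0 because p converges.
  have hstep : ∀ N, p (N + 1) = p N := by
    have hpoly : ∃ d, IsPolyLE d (fun m => shiftedQ j x (m + 1) - shiftedQ j x m -
        (logPoly x ((Polynomial.C (x : ℂ) + Polynomial.X : ℂ[X]) ^ j)).eval m) := by
      have hsh : ∃ d, IsPolyLE d (shiftedQ j x) := by
        unfold shiftedQ
        refine ⟨max (logPoly x (bernoulliShift j x)).natDegree (j + 1), ?_⟩
        refine ((IsPolyLE.eval _).mono (le_max_left _ _)).add ?_ |>.sub ?_
        · have := ((isPolyLE_P j).comp_add_const (x : ℂ)).mono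
            (le_max_right (logPoly x (bernoulliShift j x)).natDegree (j + 1))
          simpa only [add_comm] using this
        · refine IsPolyLE.sum fun r hr => ((isPolyLE_P r).const_mul _).mono ?_
          have := Finset.mem_range.mp hr
          exact le_trans (by omega) (le_max_right _ _)
      obtain ⟨d, hd⟩ := hsh
      exact ⟨max d _, (((hd.comp_add_const 1).sub hd).mono (le_max_left _ _)).sub
        ((IsPolyLE.eval _).mono (le_max_right _ _))⟩
    obtain ⟨d, hd⟩ := hpoly
    have heq : ∀ N, p (N + 1) - p N = shiftedQ j x (((N : ℂ) + 1) + 1) - shiftedQ j x ((N : ℂ) + 1) -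
        (logPoly x ((Polynomial.C (x : ℂ) + Polynomial.X : ℂ[X]) ^ j)).eval ((N : ℂ) + 1) := by
      intro N
      simp only [hp, Finset.sum_range_succ]
      push_cast
      ring
    have hlim : Tendsto (fun N => p (N + 1) - p N) atTop (𝓝 0) := by
      have := ((tendsto_add_atTop_iff_nat 1).mpr hpl').sub hpl'
      simpa only [sub_self] using this
    simp only [heq] at hlim
    intro N
    rw [← sub_eq_zero, heq]
    exact hd.eq_zero_of_tendsto hlim _
  -- At N = 0 the sum is empty and `shiftedQ j x 1` remains, which is Q_j(x).
  have hconst : ∀ N, p N = Q j x := by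
    intro N
    induction N with
    | zero => simp [hp, shiftedQ_one]
    | succ N ih => rw [hstep, ih]
  have hlast := tendsto_nhds_unique hpl' (tendsto_const_nhds.congr fun N => (hconst N).symm)
  convert hZ using 2
  push_cast at hlast
  linear_combination -hlast

/-! ### The polynomial binom(z-u, m) and closed forms of F and Φ. -/

/-- `binom(z - u, m)` as a polynomial in `u`. -/
noncomputable def binomPoly (m : ℕ) (z : ℂ) : ℂ[X] :=
  Ring.choose (Polynomial.C z - Polynomial.X : ℂ[X]) m

theorem coeffG_succ (m j : ℕ) (z : ℂ) : coeffG (m + 1) j z = (binomPoly m z).coeff j := rfl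

theorem eval_binomPoly (m : ℕ) (z w : ℂ) : (binomPoly m z).eval w = Ring.choose (z - w) m := by
  have := Ring.map_choose (Polynomial.evalRingHom w) (Polynomial.C z - Polynomial.X) m
  simpa [binomPoly] using this

theorem factorial_smul_choose {R : Type*} [Ring R] [BinomialRing R] (a : R) (m : ℕ) :
    m.factorial • Ring.choose a m =
      ∑ r ∈ Finset.range (m + 1), (descPochhammer ℤ m).coeff r • a ^ r := by
  rw [← Ring.descPochhammer_eq_factorial_smul_choose, Polynomial.smeval_eq_sum,
    Polynomial.sum_over_range' _ _ (m + 1)]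
  · simp [Polynomial.smul_pow]
  · rw [descPochhammer_natDegree]; omega
  · simp [Polynomial.smul_pow]

theorem natDegree_binomPoly_le (m : ℕ) (z : ℂ) : (binomPoly m z).natDegree ≤ m := by
  have h := factorial_smul_choose (Polynomial.C z - Polynomial.X : ℂ[X]) m
  have h1 : (m.factorial • Ring.choose (Polynomial.C z - Polynomial.X : ℂ[X]) m).natDegree ≤ m := by
    rw [h]
    refine Polynomial.natDegree_sum_le_of_forall_le _ _ fun r hr => ?_
    have hr' : r ≤ m := by have := Finset.mem_range.mp hr; omega
    refine (Polynomial.natDegree_smul_le _ _).trans ((Polynomial.natDegree_pow_le).trans ?_)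
    have : (Polynomial.C z - Polynomial.X : ℂ[X]).natDegree ≤ 1 :=
      (Polynomial.natDegree_sub_le _ _).trans (by simp)
    calc r * _ ≤ r * 1 := by gcongr
      _ ≤ m := by omega
  rw [nsmul_eq_mul] at h1
  have h2 : (m.factorial : ℂ) ≠ 0 := by exact_mod_cast m.factorial_ne_zero
  rw [← Polynomial.C_eq_natCast, Polynomial.natDegree_C_mul h2] at h1
  exact h1

/-- Vandermonde's identity separates z from u, so that the degree in z of each coefficient can be
read off. -/
theorem binomPoly_eq_sum (m : ℕ) (z : ℂ) : binomPoly m z =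
    ∑ ij ∈ Finset.HasAntidiagonal.antidiagonal m, Polynomial.C (Ring.choose z ij.1) * binomPoly ij.2 0 := by
  have h1 : (Polynomial.C z - Polynomial.X : ℂ[X]) = Polynomial.C z + (Polynomial.C 0 - Polynomial.X) := by
    simp [sub_eq_add_neg]
  rw [binomPoly, h1, Ring.add_choose_eq m (Commute.all _ _)]
  refine Finset.sum_congr rfl fun ij _ => ?_
  rw [Ring.map_choose Polynomial.C, binomPoly]

theorem isPolyLE_choose (m : ℕ) : IsPolyLE m (fun z => Ring.choose z m) := by
  have h : ∀ z : ℂ, Ring.choose z m =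
      (m.factorial : ℂ)⁻¹ * ∑ r ∈ Finset.range (m + 1), ((descPochhammer ℤ m).coeff r : ℂ) * z ^ r := by
    intro z
    have h2 : (m.factorial : ℂ) ≠ 0 := by exact_mod_cast m.factorial_ne_zero
    have h1 := factorial_smul_choose z m
    simp only [nsmul_eq_mul, zsmul_eq_mul] at h1
    rw [← h1, inv_mul_cancel_left₀ h2]
  simp only [h]
  refine IsPolyLE.const_mul (IsPolyLE.sum fun r hr => ((IsPolyLE.pow_id r).const_mul _).mono ?_) _
  have := Finset.mem_range.mp hr; omega

theorem isPolyLE_coeff_binomPoly (m j : ℕ) :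
    IsPolyLE (m - j) (fun z => (binomPoly m z).coeff j) := by
  have h : ∀ z, (binomPoly m z).coeff j =
      ∑ ij ∈ Finset.HasAntidiagonal.antidiagonal m, Ring.choose z ij.1 * (binomPoly ij.2 0).coeff j := by
    intro z
    rw [binomPoly_eq_sum, Polynomial.finsetSum_coeff]
    simp
  simp only [h]
  refine IsPolyLE.sum fun ij hij => ?_
  have hs := Finset.HasAntidiagonal.mem_antidiagonal.mp hij
  rcases lt_or_ge ij.2 j with hj | hj
  · rw [Polynomial.coeff_eq_zero_of_natDegree_lt ((natDegree_binomPoly_le _ _).trans_lt hj)]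
    simpa using (IsPolyLE.const 0).mono (Nat.zero_le _)
  · exact ((isPolyLE_choose ij.1).mul_const _).mono (by omega)

theorem binomPoly_comp (m : ℕ) (z : ℂ) :
    (binomPoly m z).comp (Polynomial.C z + Polynomial.X) = binomPoly m 0 := by
  have := Ring.map_choose (Polynomial.compRingHom (Polynomial.C z + Polynomial.X))
    (Polynomial.C z - Polynomial.X : ℂ[X]) m
  simp only [Polynomial.coe_compRingHom_apply] at this
  rw [binomPoly, this, binomPoly]
  congr 1
  simp

/-- Substituting u = z + k in binom(z-u, m) leaves binom(-k, m). The weighted sum of the (z+k)^j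
thus loses its dependence on z, which accounts for the integer exponents in the product. -/
theorem binomPoly_zero_eq_sum (m : ℕ) (z : ℂ) : binomPoly m 0 = ∑ j ∈ Finset.range (m + 1),
    (binomPoly m z).coeff j • (Polynomial.C z + Polynomial.X : ℂ[X]) ^ j := by
  rw [← binomPoly_comp m z, Polynomial.comp,
    Polynomial.eval₂_eq_sum_range' _ (Nat.lt_succ_of_le (natDegree_binomPoly_le m z))]
  simp [Polynomial.smul_eq_C_mul]

theorem binomPoly_add_one (m : ℕ) (z : ℂ) :
    binomPoly (m + 1) (z + 1) = binomPoly (m + 1) z + binomPoly m z := by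
  have := Ring.choose_succ_succ (Polynomial.C z - Polynomial.X : ℂ[X]) m
  rw [binomPoly, binomPoly, binomPoly, add_comm (Ring.choose _ (m + 1)), ← this]
  congr 1
  simp
  ring

theorem iteratedDeriv_polynomial_eval (p : ℂ[X]) (r : ℕ) :
    iteratedDeriv r (fun u => p.eval u) = fun u => (Polynomial.derivative^[r] p).eval u := by
  induction r with
  | zero => simp
  | succ r ih =>
    rw [iteratedDeriv_succ, ih, Function.iterate_succ_apply']
    ext u
    exact Polynomial.deriv _

theorem iteratedDeriv_choose (m r : ℕ) (z w : ℂ) :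
    1 / (r.factorial : ℂ) * iteratedDeriv r (fun u : ℂ => Ring.choose (z - u) m) w =
      ∑ j ∈ Finset.range (m + 1), (j.choose r : ℂ) * (binomPoly m z).coeff j * w ^ (j - r) := by
  have h1 : (fun u : ℂ => Ring.choose (z - u) m) = fun u => (binomPoly m z).eval u := by
    ext u; rw [eval_binomPoly]
  have h2 : (r.factorial : ℂ) ≠ 0 := by exact_mod_cast r.factorial_ne_zero
  have h3 := congrArg (fun f => f (binomPoly m z))
        (Polynomial.factorial_smul_hasseDeriv (R := ℂ) r)
  simp only [LinearMap.smul_apply] at h3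
  rw [h1, iteratedDeriv_polynomial_eval, ← h3]
  rw [nsmul_eq_mul]
  beta_reduce
  rw [Polynomial.eval_mul, Polynomial.eval_natCast, ← mul_assoc, one_div_mul_cancel h2, one_mul, Polynomial.hasseDeriv_apply,
    Polynomial.sum_over_range' _ (by simp) _ (Nat.lt_succ_of_le (natDegree_binomPoly_le m z)),
    Polynomial.eval_finsetSum]
  simp

theorem integral_choose (m : ℕ) (z : ℂ) :
    ∫ t in (0 : ℝ)..1, Ring.choose (z - (t : ℂ) * z) m * z =
      ∑ j ∈ Finset.range (m + 1), (binomPoly m z).coeff j * (z ^ (j + 1) / (j + 1)) := by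
  have h1 : ∀ t : ℝ, Ring.choose (z - (t : ℂ) * z) m * z =
      ∑ j ∈ Finset.range (m + 1), (binomPoly m z).coeff j * z ^ (j + 1) * ((t ^ j : ℝ) : ℂ) := by
    intro t
    rw [← eval_binomPoly, Polynomial.eval_eq_sum_range' (Nat.lt_succ_of_le
      (natDegree_binomPoly_le m z)), Finset.sum_mul]
    refine Finset.sum_congr rfl fun j _ => ?_
    push_cast; ring
  simp only [h1]
  rw [intervalIntegral.integral_finsetSum]
  · refine Finset.sum_congr rfl fun j _ => ?_
    rw [intervalIntegral.integral_const_mul, intervalIntegral.integral_ofReal, integral_pow]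
    push_cast; simp; ring
  · intro j _
    apply Continuous.intervalIntegrable
    fun_prop

/-- Regrouped by j, F is the combination, with the coefficients of binom(z-u, m), of the constant
parts of ζ'(-j, z+1) - ζ'(-j). -/
theorem F_succ (m : ℕ) (z : ℂ) : F (m + 1) z = ∑ j ∈ Finset.range (m + 1),
    (binomPoly m z).coeff j * (Q j z + ∑ r ∈ Finset.range (j + 1), (j.choose r : ℂ) * z ^ (j - r) *
      deriv riemannZeta (-(r : ℂ)) - deriv riemannZeta (-(j : ℂ)) -
      Real.eulerMascheroniConstant * (z ^ (j + 1) / (j + 1))) := by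
  have h0 : ∀ r, ∑ j ∈ Finset.range (m + 1), (j.choose r : ℂ) * (binomPoly m z).coeff j *
      (0 : ℂ) ^ (j - r) = (binomPoly m z).coeff r := by
    intro r
    rcases lt_or_ge m r with h | h
    · rw [Polynomial.coeff_eq_zero_of_natDegree_lt ((natDegree_binomPoly_le m z).trans_lt h)]
      refine Finset.sum_eq_zero fun j hj => ?_
      rw [Nat.choose_eq_zero_of_lt (by have := Finset.mem_range.mp hj; omega)]; simp
    · rw [Finset.sum_eq_single r]
      · simp
      · intro j _ hj
        rcases lt_or_gt_of_ne hj with h | h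
        · rw [Nat.choose_eq_zero_of_lt h]; simp
        · rw [zero_pow (by omega)]; simp
      · intro h'; exact absurd (Finset.mem_range.mpr (by omega)) h'
  -- The m-th u-derivative of a polynomial of degree at most m is constant, so r = m contributes no
  -- difference; hence the ζ' sum in F may omit it.
  have hlast : ∑ j ∈ Finset.range (m + 1), (j.choose m : ℂ) * (binomPoly m z).coeff j *
      z ^ (j - m) = (binomPoly m z).coeff m := by
    rw [Finset.sum_range_succ, Finset.sum_eq_zero]
    · simp
    · intro j hj
      rw [Nat.choose_eq_zero_of_lt (Finset.mem_range.mp hj)]; simp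
  have hmid : ∑ r ∈ Finset.range m,
      (1 / (r.factorial : ℂ) * iteratedDeriv r (fun u : ℂ => Ring.choose (z - u) m) z
        - 1 / (r.factorial : ℂ) * iteratedDeriv r (fun u : ℂ => Ring.choose (z - u) m) 0)
        * deriv riemannZeta (-(r : ℂ)) =
      ∑ r ∈ Finset.range (m + 1), (∑ j ∈ Finset.range (m + 1), (j.choose r : ℂ) *
        (binomPoly m z).coeff j * z ^ (j - r) - (binomPoly m z).coeff r) *
          deriv riemannZeta (-(r : ℂ)) := by
    rw [Finset.sum_range_succ, hlast, sub_self, zero_mul, add_zero]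
    refine Finset.sum_congr rfl fun r _ => ?_
    rw [iteratedDeriv_choose, iteratedDeriv_choose, h0]
  have hswap : ∑ r ∈ Finset.range (m + 1), (∑ j ∈ Finset.range (m + 1), (j.choose r : ℂ) *
        (binomPoly m z).coeff j * z ^ (j - r)) * deriv riemannZeta (-(r : ℂ)) =
      ∑ j ∈ Finset.range (m + 1), (binomPoly m z).coeff j * ∑ r ∈ Finset.range (j + 1),
        (j.choose r : ℂ) * z ^ (j - r) * deriv riemannZeta (-(r : ℂ)) := by
    simp only [Finset.sum_mul, Finset.mul_sum]
    rw [Finset.sum_comm]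
    refine Finset.sum_congr rfl fun j hj => ?_
    have hjm : j + 1 ≤ m + 1 := by have := Finset.mem_range.mp hj; omega
    rw [← Finset.sum_subset (Finset.range_mono hjm)]
    · exact Finset.sum_congr rfl fun r _ => by ring
    · intro r _ hr
      rw [Nat.choose_eq_zero_of_lt (by rw [Finset.mem_range] at hr; omega)]; simp
  rw [F, Nat.add_sub_cancel, hmid, integral_choose]
  simp only [coeffG_succ, mul_sub, mul_add, sub_mul, Finset.sum_sub_distrib,
    Finset.sum_add_distrib, hswap]
  have : ∑ j ∈ Finset.range (m + 1), (binomPoly m z).coeff j *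
      (Real.eulerMascheroniConstant * (z ^ (j + 1) / (j + 1))) =
      (∑ j ∈ Finset.range (m + 1), (binomPoly m z).coeff j * (z ^ (j + 1) / (j + 1))) *
        (Real.eulerMascheroniConstant : ℂ) := by
    rw [Finset.sum_mul]
    exact Finset.sum_congr rfl fun j _ => by ring
  rw [this]
  ring

/-- The coefficient of u^j has degree at most m-j in z, and its cofactor at most j+1. -/
theorem isPolyLE_F (m : ℕ) : IsPolyLE (m + 1) (F (m + 1)) := by
  have h : F (m + 1) = fun z => _ := funext (F_succ m)
  rw [h]
  refine IsPolyLE.sum fun j hj => ?_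
  have hj' : j ≤ m := by have := Finset.mem_range.mp hj; omega
  refine ((isPolyLE_coeff_binomPoly m j).mul (e := j + 1) ?_).mono (by omega)
  refine (((isPolyLE_Q j).add (IsPolyLE.sum fun r _ => ?_)).sub
    ((IsPolyLE.const _).mono (Nat.zero_le _))).sub ?_
  · exact (((IsPolyLE.pow_id (j - r)).const_mul _).mul_const _).mono (by omega)
  · simp only [div_eq_mul_inv]
    exact ((IsPolyLE.pow_id (j + 1)).mul_const _).const_mul _

theorem binomPoly_zero_eq_sum_monomial (m : ℕ) : binomPoly m 0 = ∑ r ∈ Finset.range (m + 1),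
    Polynomial.monomial r ((m.factorial : ℂ)⁻¹ * (stirlingS m r * (-1) ^ r)) := by
  have h2 : (m.factorial : ℂ) ≠ 0 := by exact_mod_cast m.factorial_ne_zero
  have h := factorial_smul_choose (Polynomial.C 0 - Polynomial.X : ℂ[X]) m
  rw [nsmul_eq_mul, ← Polynomial.C_eq_natCast] at h
  have h3 := congrArg (fun p => Polynomial.C (m.factorial : ℂ)⁻¹ * p) h
  simp only [← mul_assoc, ← Polynomial.C_mul, inv_mul_cancel₀ h2, map_one, one_mul] at h3
  rw [binomPoly, h3, Finset.mul_sum]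
  refine Finset.sum_congr rfl fun r _ => ?_
  rw [map_zero, zero_sub, neg_pow, ← Polynomial.C_mul_X_pow_eq_monomial, stirlingS, zsmul_eq_mul]
  simp only [map_mul, map_pow, map_neg, map_one, map_intCast]
  ring

theorem pow_mul_logTaylor (r : ℕ) (z : ℂ) {k : ℂ} (hk : k ≠ 0) :
    k ^ r * Complex.logTaylor (r + 2) (z / k) = ∑ a ∈ Finset.range (r + 1),
      (-1) ^ (r + a) * (z ^ (r + 1 - a) / ((r + 1 - a : ℕ) : ℂ)) * k ^ ((a : ℤ) - 1) := by
  rw [Complex.logTaylor, Finset.sum_range_succ', ← Finset.sum_flip]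
  simp only [Nat.cast_zero, div_zero, add_zero, Finset.mul_sum]
  refine Finset.sum_congr rfl fun a ha => ?_
  have har : a ≤ r := by have := Finset.mem_range.mp ha; omega
  obtain ⟨d, rfl⟩ := Nat.exists_eq_add_of_le har
  have e1 : a + d - a + 1 = d + 1 := by omega
  have e2 : a + d + 1 - a = d + 1 := by omega
  have hd : ((d + 1 : ℕ) : ℂ) ≠ 0 := by exact_mod_cast d.succ_ne_zero
  rw [e1, e2, zpow_sub_one₀ hk, zpow_natCast, div_pow]
  have e3 : (-1 : ℂ) ^ (a + d + a) = (-1) ^ (d + 1 + 1) := by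
    rw [show a + d + a = d + 2 * a by ring, pow_add, pow_mul, show d + 1 + 1 = d + 2 by ring,
      pow_add]
    simp
  rw [e3, pow_add k a d]
  field_simp
  ring

/-- Expanding binom(-k, m) by Stirling numbers and the logarithm by its Taylor series, Φ collects
exactly the terms of binom(-k, m) log(1 + z/k) down to order 1/k. -/
theorem Phi_succ (m : ℕ) (z : ℂ) {k : ℕ} (hk : k ≠ 0) :
    Phi (m + 1) z k = logTrunc z (binomPoly m 0) k := by
  have hk' : (k : ℂ) ≠ 0 := by exact_mod_cast hk
  have hlin : logTrunc z (binomPoly m 0) k = ∑ r ∈ Finset.range (m + 1),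
      logTrunc z (Polynomial.monomial r ((m.factorial : ℂ)⁻¹ * (stirlingS m r * (-1) ^ r))) k := by
    rw [binomPoly_zero_eq_sum_monomial]
    simp only [logTrunc, map_sum, Polynomial.eval_finsetSum, Finset.sum_add_distrib,
      Finset.sum_div]
  rw [hlin]
  simp only [logTrunc_monomial z _ _ hk', pow_mul_logTaylor _ z hk', Finset.mul_sum]
  rw [Phi, Nat.add_sub_cancel]
  simp only [Finset.sum_mul, Finset.mul_sum]
  simp only [Finset.range_eq_Ico]
  rw [Finset.sum_Ico_Ico_comm]
  refine Finset.sum_congr rfl fun r _ => Finset.sum_congr rfl fun a _ => ?_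
  have : (-1 : ℂ) ^ r * (-1) ^ (r + a) = (-1) ^ a := by
    rw [← pow_add, show r + (r + a) = a + 2 * r by ring, pow_add, pow_mul]; simp
  rw [← this]
  ring

/-! ### The logarithm of the multiple gamma function on the real axis. -/

/-- The derivative of the Hurwitz zeta function `s ↦ ζ(s, y)` at `s = -j`. -/
noncomputable def hurwitzDeriv (j : ℕ) (y : ℝ) : ℂ := limUnder atTop fun N => zetaDerivApprox j N y

theorem tendsto_hurwitzDeriv (j : ℕ) {y : ℝ} (hy : 0 < y) :
    Tendsto (fun N => zetaDerivApprox j N y) atTop (𝓝 (hurwitzDeriv j y)) :=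
  tendsto_nhds_limUnder (exists_tendsto_zetaDerivApprox j hy)

theorem hurwitzDeriv_one (j : ℕ) : hurwitzDeriv j 1 = deriv riemannZeta (-(j : ℂ)) :=
  (tendsto_zetaDerivApprox_one j).limUnder_eq

/-- Shifting y to y+1 with N terms is the same as using N+1 terms at y and dropping the summand k =
0. -/
theorem hurwitzDeriv_add_one (j : ℕ) {y : ℝ} (hy : 0 < y) :
    hurwitzDeriv j (y + 1) = hurwitzDeriv j y + (y : ℂ) ^ j * (Real.log y : ℂ) := by
  have h1 := tendsto_hurwitzDeriv j (y := y + 1) (by linarith)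
  have h2 := ((tendsto_add_atTop_iff_nat 1).mpr (tendsto_hurwitzDeriv j hy)).add_const
    ((y : ℂ) ^ j * (Real.log y : ℂ))
  refine tendsto_nhds_unique h1 (h2.congr fun N => ?_)
  rw [zetaDerivApprox, zetaDerivApprox, Finset.sum_range_succ']
  have e : ∀ k : ℕ, y + (k + 1 : ℕ) = y + 1 + k := by intro k; push_cast; ring
  simp only [e, Nat.cast_zero, add_zero]
  ring

theorem bernoulliPoly_ofReal (n : ℕ) (x : ℝ) : ∃ r : ℝ, bernoulliPoly n (x : ℂ) = r :=
  ⟨Polynomial.aeval x (Polynomial.bernoulli n), by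
    rw [bernoulliPoly]; exact Polynomial.aeval_algebraMap_apply ℂ x _⟩

theorem P_ofReal (j : ℕ) (x : ℝ) : ∃ r : ℝ, P j (x : ℂ) = r :=
  ⟨∑ r ∈ Finset.range (j + 2), (bernoulli r : ℝ) / (r.factorial : ℝ) * phi j r * x ^ (j + 1 - r), by
    rw [P]; push_cast; rfl⟩

theorem zetaDerivApprox_im (j N : ℕ) (y : ℝ) : (zetaDerivApprox j N y).im = 0 := by
  obtain ⟨a, ha⟩ := bernoulliPoly_ofReal (j + 1) (y + N)
  obtain ⟨b, hb⟩ := P_ofReal j (y + N)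
  have : zetaDerivApprox j N y = ((a / (j + 1) * Real.log (y + N) + b -
      ∑ k ∈ Finset.range N, (y + k) ^ j * Real.log (y + k) : ℝ) : ℂ) := by
    rw [zetaDerivApprox, ha, hb]; push_cast; rfl
  rw [this, Complex.ofReal_im]

theorem hurwitzDeriv_im (j : ℕ) {y : ℝ} (hy : 0 < y) : (hurwitzDeriv j y).im = 0 := by
  have h := (Complex.continuous_im.tendsto _).comp (tendsto_hurwitzDeriv j hy)
  refine tendsto_nhds_unique h ?_
  simp only [Function.comp_def, zetaDerivApprox_im]
  exact tendsto_const_nhds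

/-- The logarithm of the multiple gamma function `G_{m+1}` at `x + 1`. -/
noncomputable def logMultipleGamma (m : ℕ) (x : ℝ) : ℂ :=
  ∑ j ∈ Finset.range (m + 1), (binomPoly m x).coeff j *
    (hurwitzDeriv j (x + 1) - hurwitzDeriv j 1)

theorem logMultipleGamma_zero (m : ℕ) : logMultipleGamma m 0 = 0 := by
  simp [logMultipleGamma]

theorem binomPoly_coeff_im (m j : ℕ) (x : ℝ) : ((binomPoly m (x : ℂ)).coeff j).im = 0 := by
  have h := Ring.map_choose (Polynomial.mapRingHom Complex.ofRealHom)
    (Polynomial.C x - Polynomial.X : Polynomial ℝ) m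
  simp only [Polynomial.coe_mapRingHom, Polynomial.map_sub, Polynomial.map_C, Polynomial.map_X,
    Complex.ofRealHom_eq_coe] at h
  rw [binomPoly, ← h, Polynomial.coeff_map]
  simp

theorem logMultipleGamma_im (m : ℕ) {x : ℝ} (hx : -1 < x) : (logMultipleGamma m x).im = 0 := by
  rw [logMultipleGamma, Complex.im_sum]
  refine Finset.sum_eq_zero fun j _ => ?_
  rw [Complex.mul_im, binomPoly_coeff_im, Complex.sub_im, hurwitzDeriv_im j (by linarith),
    hurwitzDeriv_im j one_pos]
  simp

theorem sum_binomPoly_coeff (m : ℕ) (z w : ℂ) {M : ℕ} (hM : m + 1 ≤ M) :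
    ∑ j ∈ Finset.range M, (binomPoly m z).coeff j * w ^ j = Ring.choose (z - w) m := by
  rw [← eval_binomPoly, Polynomial.eval_eq_sum_range'
    (lt_of_lt_of_le (Nat.lt_succ_of_le (natDegree_binomPoly_le m z)) hM)]

/-- The jumps (x+1)^j log(x+1), weighted by the coefficients of binom(x+1-u, m), sum to that
polynomial at u = x+1, namely binom(0, m). It is 1 for m = 0 and vanishes otherwise. -/
theorem logMultipleGamma_add_one_aux (m : ℕ) {x : ℝ} (hx : -1 < x) :
    logMultipleGamma m (x + 1) = ∑ j ∈ Finset.range (m + 1), (binomPoly m (x + 1)).coeff j *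
      (hurwitzDeriv j (x + 1) - hurwitzDeriv j 1) + Ring.choose (0 : ℂ) m * Real.log (x + 1) := by
  have h := sum_binomPoly_coeff m ((x : ℂ) + 1) (x + 1) le_rfl
  rw [sub_self] at h
  rw [logMultipleGamma, ← h, Finset.sum_mul, ← Finset.sum_add_distrib]
  refine Finset.sum_congr rfl fun j _ => ?_
  rw [hurwitzDeriv_add_one j (show 0 < x + 1 by linarith)]
  push_cast
  ring

theorem logMultipleGamma_zero_add_one {x : ℝ} (hx : -1 < x) :
    logMultipleGamma 0 (x + 1) = logMultipleGamma 0 x + Real.log (x + 1) := by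
  rw [logMultipleGamma_add_one_aux 0 hx, logMultipleGamma]
  simp [binomPoly]

theorem logMultipleGamma_succ_add_one (m : ℕ) {x : ℝ} (hx : -1 < x) :
    logMultipleGamma (m + 1) (x + 1) = logMultipleGamma (m + 1) x + logMultipleGamma m x := by
  rw [logMultipleGamma_add_one_aux (m + 1) hx, Ring.choose_zero_succ, binomPoly_add_one]
  simp only [Polynomial.coeff_add, add_mul, Finset.sum_add_distrib, zero_mul, add_zero]
  rw [← logMultipleGamma, Finset.sum_range_succ _ (m + 1), Polynomial.coeff_eq_zero_of_natDegree_lt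
    ((natDegree_binomPoly_le m x).trans_lt (Nat.lt_succ_self m))]
  rw [zero_mul, add_zero, ← logMultipleGamma]

/-- The `k`-th term (indexed from `0`) of the logarithm of the Weierstrass product. -/
noncomputable def logTerm (m k : ℕ) (z : ℂ) : ℂ :=
  logTrunc z (binomPoly m 0) ((k : ℂ) + 1) -
    (binomPoly m 0).eval ((k : ℂ) + 1) * Complex.log (1 + z / ((k : ℂ) + 1))

/-- The expansions of ζ'(-j, x+1) are summed against the coefficients of binom(x-u, m): the
constants form F, and `binomPoly_zero_eq_sum` merges the series into one. -/
theorem logMultipleGamma_eq (m : ℕ) {x : ℝ} (hx : -1 < x) :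
    logMultipleGamma m x = F (m + 1) x + ∑' k : ℕ, logTerm m k x := by
  have h1 : ∀ j, hurwitzDeriv j (x + 1) = _ := fun j =>
    (tendsto_zetaDerivApprox j hx).limUnder_eq
  have h2 : ∑' k : ℕ, logTerm m k x = -∑ j ∈ Finset.range (m + 1), (binomPoly m x).coeff j *
      ∑' k : ℕ, (((Polynomial.C (x : ℂ) + Polynomial.X : ℂ[X]) ^ j).eval ((k : ℂ) + 1) *
          Complex.log (1 + x / ((k : ℂ) + 1)) -
          logTrunc x ((Polynomial.C (x : ℂ) + Polynomial.X : ℂ[X]) ^ j) ((k : ℂ) + 1)) := by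
    simp only [← tsum_mul_left]
    rw [← Summable.tsum_finsetSum fun j _ => (summable_log_term _ _).mul_left _, ← tsum_neg]
    refine tsum_congr fun k => ?_
    rw [logTerm, binomPoly_zero_eq_sum m x]
    simp only [logTrunc, map_sum, map_smul, Polynomial.eval_finsetSum, Polynomial.eval_smul,
      smul_eq_mul, mul_sub, mul_add, Finset.sum_sub_distrib, Finset.sum_add_distrib, Finset.sum_mul,
      Finset.sum_div]
    simp only [mul_assoc, mul_div_assoc]
    ring
  rw [h2, F_succ, ← sub_eq_add_neg, ← Finset.sum_sub_distrib, logMultipleGamma]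
  refine Finset.sum_congr rfl fun j _ => ?_
  rw [h1 j, hurwitzDeriv_one]
  ring

end MultipleGamma

/-! ### Sign and decay of the (m+2)-nd derivative. -/

theorem TendstoLocallyUniformlyOn.iteratedDeriv {F : ℕ → ℂ → ℂ} {f : ℂ → ℂ} {U : Set ℂ}
    (hf : TendstoLocallyUniformlyOn F f atTop U) (hF : ∀ N, DifferentiableOn ℂ (F N) U)
    (hU : IsOpen U) (n : ℕ) :
    TendstoLocallyUniformlyOn (fun N => _root_.iteratedDeriv n (F N)) (_root_.iteratedDeriv n f)
      atTop U ∧ ∀ N, DifferentiableOn ℂ (_root_.iteratedDeriv n (F N)) U := by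
  induction n with
  | zero => simpa using ⟨hf, hF⟩
  | succ n ih =>
    simp only [iteratedDeriv_succ]
    exact ⟨ih.1.deriv (.of_forall ih.2) hU, fun N => (ih.2 N).deriv hU⟩

theorem DifferentiableOn.iteratedDeriv_re_ofReal {H : ℂ → ℂ} {U : Set ℂ} (hU : IsOpen U)
    (hH : DifferentiableOn ℂ H U) (n : ℕ) (x : ℝ) (hx : (x : ℂ) ∈ U) :
    iteratedDeriv n (fun t : ℝ => (H t).re) x = (iteratedDeriv n H x).re := by
  induction n generalizing x with
  | zero => simp
  | succ n ih =>
    rw [iteratedDeriv_succ, iteratedDeriv_succ]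
    have hV : {t : ℝ | (t : ℂ) ∈ U} ∈ 𝓝 x :=
      (hU.preimage Complex.continuous_ofReal).mem_nhds hx
    have he : iteratedDeriv n (fun t : ℝ => (H t).re) =ᶠ[𝓝 x] fun t => (iteratedDeriv n H t).re := by
      filter_upwards [hV] with t ht using ih t ht
    rw [he.deriv_eq]
    have hd : DifferentiableOn ℂ (iteratedDeriv n H) U := by
      clear ih he
      induction n with
      | zero => simpa using hH
      | succ n ih => rw [iteratedDeriv_succ]; exact ih.deriv hU
    exact ((hd.differentiableAt (hU.mem_nhds hx)).hasDerivAt.real_of_complex).deriv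

namespace MultipleGamma

theorem IsPolyLE.iteratedDeriv_eq_zero {d n : ℕ} {f : ℂ → ℂ} (hf : IsPolyLE d f) (hn : d < n) :
    iteratedDeriv n f = 0 := by
  obtain ⟨p, hp, hf⟩ := hf
  rw [show f = fun z => p.eval z from funext hf, iteratedDeriv_polynomial_eval,
    Polynomial.iterate_derivative_eq_zero (hp.trans_lt hn)]
  ext; simp

theorem IsPolyLE.differentiable {d : ℕ} {f : ℂ → ℂ} (hf : IsPolyLE d f) : Differentiable ℂ f := by
  obtain ⟨p, hp, hf⟩ := hf
  rw [show f = fun z => p.eval z from funext hf]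
  exact p.differentiable

theorem isPolyLE_logTrunc (p : ℂ[X]) {k : ℂ} (hk : k ≠ 0) :
    IsPolyLE (p.natDegree + 1) (fun z => logTrunc z p k) := by
  have h : ∀ z, logTrunc z p k = ∑ r ∈ Finset.range (p.natDegree + 1),
      p.coeff r * (k ^ r * ∑ j ∈ Finset.range (r + 2), (-1) ^ (j + 1) * (z / k) ^ j / j) := by
    intro z
    conv_lhs => rw [p.as_sum_range]
    have : ∀ r, p.coeff r * (k ^ r * ∑ j ∈ Finset.range (r + 2), (-1) ^ (j + 1) * (z / k) ^ j / j) =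
        logTrunc z (Polynomial.monomial r (p.coeff r)) k := fun r => (logTrunc_monomial z r _ hk).symm
    simp only [this]
    simp only [logTrunc, map_sum, Polynomial.eval_finsetSum, Finset.sum_add_distrib, Finset.sum_div]
  simp only [h]
  refine IsPolyLE.sum fun r hr => IsPolyLE.const_mul (IsPolyLE.const_mul (IsPolyLE.sum fun j hj => ?_) _) _
  have hr' := Finset.mem_range.mp hr
  have hj' := Finset.mem_range.mp hj
  simp only [div_eq_mul_inv, mul_pow]
  exact ((((IsPolyLE.pow_id j).mul_const _).const_mul _).mul_const _).mono (by omega)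

theorem isPolyLE_logTrunc_binomPoly (m : ℕ) {k : ℂ} (hk : k ≠ 0) :
    IsPolyLE (m + 1) (fun z => logTrunc z (binomPoly m 0) k) :=
  (isPolyLE_logTrunc _ hk).mono (by have := natDegree_binomPoly_le m 0; omega)

theorem natCast_add_one_ne_zero (k : ℕ) : (k : ℂ) + 1 ≠ 0 := by exact_mod_cast k.succ_ne_zero

/-- The half plane to the right of the first singularity `-1`. -/
def rightHalf : Set ℂ := {z | -1 < z.re}

theorem isOpen_rightHalf : IsOpen rightHalf := isOpen_lt continuous_const Complex.continuous_re

theorem ofReal_mem_rightHalf {x : ℝ} : (x : ℂ) ∈ rightHalf ↔ -1 < x := Iff.rfl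

theorem one_add_div_mem_slitPlane {z : ℂ} (hz : z ∈ rightHalf) (k : ℕ) :
    1 + z / ((k : ℂ) + 1) ∈ Complex.slitPlane := by
  left
  have h : ((k : ℂ) + 1) = ((k + 1 : ℝ) : ℂ) := by push_cast; rfl
  rw [h, Complex.add_re, Complex.div_ofReal_re, Complex.one_re]
  have hz' : -1 < z.re := hz
  have hk : (0 : ℝ) < k + 1 := by positivity
  have : -1 < z.re / (k + 1) := by
    rw [lt_div_iff₀ hk]
    have : (0 : ℝ) ≤ k := k.cast_nonneg
    linarith
  linarith

theorem hasDerivAt_log_one_add_div {z : ℂ} (hz : z ∈ rightHalf) (k : ℕ) :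
    HasDerivAt (fun z => Complex.log (1 + z / ((k : ℂ) + 1))) ((z + (k + 1))⁻¹) z := by
  have h1 : HasDerivAt (fun z : ℂ => 1 + z / ((k : ℂ) + 1)) (1 / ((k : ℂ) + 1)) z :=
    ((hasDerivAt_id z).div_const _).const_add 1
  refine (h1.clog (one_add_div_mem_slitPlane hz k)).congr_deriv ?_
  have h2 := Complex.slitPlane_ne_zero (one_add_div_mem_slitPlane hz k)
  have hk := natCast_add_one_ne_zero k
  have h3 : 1 + z / ((k : ℂ) + 1) = (z + (k + 1)) / (k + 1) := by field_simp; ring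
  rw [h3, div_div_div_cancel_right₀ hk, one_div]

theorem iteratedDeriv_log_one_add_div (r k : ℕ) {z : ℂ} (hz : z ∈ rightHalf) :
    iteratedDeriv (r + 1) (fun z => Complex.log (1 + z / ((k : ℂ) + 1))) z =
      (-1) ^ r * r.factorial * ((z + (k + 1)) ^ (r + 1))⁻¹ := by
  induction r generalizing z with
  | zero =>
    rw [zero_add, iteratedDeriv_one, (hasDerivAt_log_one_add_div hz k).deriv]; simp
  | succ r ih =>
    rw [iteratedDeriv_succ]
    have he : iteratedDeriv (r + 1) (fun z => Complex.log (1 + z / ((k : ℂ) + 1))) =ᶠ[𝓝 z]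
        fun z => (-1) ^ r * r.factorial * ((z + (k + 1)) ^ (r + 1))⁻¹ := by
      filter_upwards [isOpen_rightHalf.mem_nhds hz] with w hw using ih hw
    have hne : z + (k + 1) ≠ 0 := by
      intro h
      have := Complex.slitPlane_ne_zero (one_add_div_mem_slitPlane hz k)
      have hk := natCast_add_one_ne_zero k
      apply this
      field_simp
      linear_combination h
    have h1 : HasDerivAt (fun z : ℂ => (z + (k + 1)) ^ (r + 1))
        (((r + 1 : ℕ) : ℂ) * (z + (k + 1)) ^ r * 1) z := by
      simpa using! ((hasDerivAt_id z).add_const ((k : ℂ) + 1)).pow (r + 1)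
    have h2 := (h1.inv (pow_ne_zero _ hne)).const_mul ((-1 : ℂ) ^ r * r.factorial)
    rw [he.deriv_eq]
    refine h2.deriv.trans ?_
    rw [Nat.factorial_succ]
    push_cast
    field_simp
    ring

theorem differentiableOn_logTerm (m k : ℕ) : DifferentiableOn ℂ (logTerm m k) rightHalf := by
  intro z hz
  exact ((isPolyLE_logTrunc_binomPoly m (natCast_add_one_ne_zero k)).differentiable z).sub
    ((hasDerivAt_log_one_add_div hz k).differentiableAt.const_mul _) |>.differentiableWithinAt

theorem choose_neg_nat (k m : ℕ) : Ring.choose (-((k : ℤ) + 1)) m = (-1) ^ m * ((k + m).choose m : ℤ) := by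
  rw [Ring.choose_neg, ← Ring.choose_natCast, Int.negOnePow_def, zpow_natCast, Units.smul_def,
    smul_eq_mul]
  push_cast
  congr 2
  ring

theorem eval_binomPoly_zero (k m : ℕ) :
    (binomPoly m 0).eval ((k : ℂ) + 1) = ((Ring.choose (-((k : ℤ) + 1)) m : ℤ) : ℂ) := by
  have := Ring.map_choose (Int.castRingHom ℂ) (-((k : ℤ) + 1)) m
  rw [eval_binomPoly, zero_sub]
  simpa using this.symm

/-- The `(m+2)`-nd derivative of `logTerm m k` at a real point. -/
noncomputable def derivTerm (m k : ℕ) (x : ℝ) : ℝ :=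
  ((k + m).choose m : ℝ) * (m + 1).factorial * ((x + (k + 1)) ^ (m + 2))⁻¹

theorem contDiffAt_of_differentiableOn {H : ℂ → ℂ} {U : Set ℂ} (hU : IsOpen U)
    (hH : DifferentiableOn ℂ H U) {z : ℂ} (hz : z ∈ U) (n : ℕ) : ContDiffAt ℂ n H z :=
  (hH.analyticAt (hU.mem_nhds hz)).contDiffAt

/-- The polynomial part has degree at most m+1 and disappears. In the logarithmic part the sign
(-1)^m of binom(-k-1, m), the sign (-1)^(m+1) of the derivative and the minus in front cancel. -/
theorem iteratedDeriv_logTerm (m k : ℕ) {x : ℝ} (hx : -1 < x) :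
    iteratedDeriv (m + 2) (logTerm m k) x = derivTerm m k x := by
  have hx' : (x : ℂ) ∈ rightHalf := hx
  have h1 := isPolyLE_logTrunc_binomPoly m (natCast_add_one_ne_zero k)
  have h2 : DifferentiableOn ℂ (fun z => Complex.log (1 + z / ((k : ℂ) + 1))) rightHalf :=
    fun z hz => (hasDerivAt_log_one_add_div hz k).differentiableAt.differentiableWithinAt
  have e : logTerm m k = (fun z => logTrunc z (binomPoly m 0) ((k : ℂ) + 1)) -
      fun z => (binomPoly m 0).eval ((k : ℂ) + 1) * Complex.log (1 + z / ((k : ℂ) + 1)) := rfl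
  rw [e, iteratedDeriv_sub
    (contDiffAt_of_differentiableOn isOpen_univ h1.differentiable.differentiableOn trivial _)
    (contDiffAt_of_differentiableOn isOpen_rightHalf (h2.const_mul _) hx' _),
    h1.iteratedDeriv_eq_zero (by omega), iteratedDeriv_const_mul_field,
    iteratedDeriv_log_one_add_div (m + 1) k hx', eval_binomPoly_zero, choose_neg_nat, derivTerm]
  have : (-1 : ℂ) ^ m * (-1) ^ (m + 1) = -1 := by
    rw [← pow_add, show m + (m + 1) = 2 * m + 1 by ring, pow_succ, pow_mul]; simp
  push_cast
  simp only [Pi.zero_apply]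
  linear_combination (-((k + m).choose m : ℂ) * (m + 1).factorial *
    (((x : ℂ) + (k + 1)) ^ (m + 1 + 1))⁻¹) * this

theorem tendstoLocallyUniformlyOn_logTerm (m : ℕ) :
    TendstoLocallyUniformlyOn (fun N z => F (m + 1) z + ∑ k ∈ Finset.range N, logTerm m k z)
      (fun z => F (m + 1) z + ∑' k, logTerm m k z) atTop rightHalf := by
  have := TendstoLocallyUniformlyOn.of_summable_sub
    (F := fun N z => F (m + 1) z + ∑ k ∈ Finset.range N, logTerm m k z) isOpen_rightHalf
    (fun K _ hK => ?_)
  · simpa [Finset.sum_range_succ] using this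
  · obtain ⟨R, hR⟩ := hK.isBounded.exists_norm_le
    obtain ⟨C, hC⟩ := norm_log_term_le (binomPoly m 0) (le_max_right R 0)
    refine ⟨_, (Real.summable_one_div_nat_pow.mpr one_lt_two).mul_left C, ?_⟩
    filter_upwards [hC] with k hk z hz
    have := hk z ((hR z hz).trans (le_max_left _ _))
    rw [norm_sub_rev] at this
    simp only [Finset.sum_range_succ]
    rwa [add_sub_add_left_eq_sub, add_sub_cancel_left, logTerm]

/-- The holomorphic logarithm of `G_{m+1}(z + 1)` on the half plane `Re z > -1`. -/
noncomputable def logW (m : ℕ) (z : ℂ) : ℂ := F (m + 1) z + ∑' k, logTerm m k z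

theorem differentiableOn_partial (m N : ℕ) : DifferentiableOn ℂ
    (fun z => F (m + 1) z + ∑ k ∈ Finset.range N, logTerm m k z) rightHalf :=
  (isPolyLE_F m).differentiable.differentiableOn.add
    (DifferentiableOn.fun_sum fun k _ => differentiableOn_logTerm m k)

theorem differentiableOn_logW (m : ℕ) : DifferentiableOn ℂ (logW m) rightHalf :=
  (tendstoLocallyUniformlyOn_logTerm m).differentiableOn
    (.of_forall (differentiableOn_partial m)) isOpen_rightHalf

theorem iteratedDeriv_partial (m N : ℕ) {x : ℝ} (hx : -1 < x) : iteratedDeriv (m + 2)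
    (fun z => F (m + 1) z + ∑ k ∈ Finset.range N, logTerm m k z) x =
      ((∑ k ∈ Finset.range N, derivTerm m k x : ℝ) : ℂ) := by
  induction N with
  | zero => simp [(isPolyLE_F m).iteratedDeriv_eq_zero (Nat.lt_succ_self (m + 1))]
  | succ N ih =>
    have e : (fun z => F (m + 1) z + ∑ k ∈ Finset.range (N + 1), logTerm m k z) =
        (fun z => F (m + 1) z + ∑ k ∈ Finset.range N, logTerm m k z) + logTerm m N := by
      ext z; simp [Finset.sum_range_succ, add_assoc]
    have hx' : (x : ℂ) ∈ rightHalf := hx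
    rw [e, iteratedDeriv_add
      (contDiffAt_of_differentiableOn isOpen_rightHalf (differentiableOn_partial m N) hx' _)
      (contDiffAt_of_differentiableOn isOpen_rightHalf (differentiableOn_logTerm m N) hx' _), ih,
      iteratedDeriv_logTerm m N hx, Finset.sum_range_succ, Complex.ofReal_add]

theorem derivTerm_nonneg (m k : ℕ) {x : ℝ} (hx : -1 < x) : 0 ≤ derivTerm m k x := by
  have : 0 ≤ x + (k + 1) := by have : (0 : ℝ) ≤ k := k.cast_nonneg
                               linarith
  rw [derivTerm]; positivity

/-- Locally uniform convergence of holomorphic functions permits termwise differentiation, and F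
drops out by degree. -/
theorem hasSum_derivTerm (m : ℕ) {x : ℝ} (hx : -1 < x) :
    HasSum (fun k => derivTerm m k x) (iteratedDeriv (m + 2) (fun t : ℝ => (logW m t).re) x) := by
  have hx' : (x : ℂ) ∈ rightHalf := hx
  rw [(differentiableOn_logW m).iteratedDeriv_re_ofReal isOpen_rightHalf _ x hx',
    hasSum_iff_tendsto_nat_of_nonneg fun k => derivTerm_nonneg m k hx]
  have h := ((tendstoLocallyUniformlyOn_logTerm m).iteratedDeriv (differentiableOn_partial m)
    isOpen_rightHalf (m + 2)).1.tendsto_at hx'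
  simp only [iteratedDeriv_partial m _ hx] at h
  have h2 := (Complex.continuous_re.tendsto _).comp h
  simpa [Function.comp_def] using! h2

theorem iteratedDeriv_logW_nonneg (m : ℕ) {x : ℝ} (hx : -1 < x) :
    0 ≤ iteratedDeriv (m + 2) (fun t : ℝ => (logW m t).re) x :=
  (hasSum_derivTerm m hx).nonneg fun k => derivTerm_nonneg m k hx

/-- Dominated convergence: every term decreases to 0 in x, so its value at x = 0 is a summable
majorant. -/
theorem tendsto_iteratedDeriv_logW (m : ℕ) :
    Tendsto (iteratedDeriv (m + 2) (fun t : ℝ => (logW m t).re)) atTop (𝓝 0) := by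
  have h0 : (0 : ℝ) = ∑' k : ℕ, (0 : ℝ) := by simp
  have h1 : Tendsto (fun x => ∑' k, derivTerm m k x) atTop (𝓝 (∑' k : ℕ, (0 : ℝ))) := by
    refine tendsto_tsum_of_dominated_convergence
      (hasSum_derivTerm m (show (-1 : ℝ) < 0 by norm_num)).summable (fun k => ?_) ?_
    · have h2 : Tendsto (fun x : ℝ => (x + (k + 1)) ^ (m + 2)) atTop atTop :=
        (tendsto_pow_atTop (by omega)).comp (tendsto_atTop_add_const_right _ _ tendsto_id)
      have := (tendsto_inv_atTop_zero.comp h2).const_mul (((k + m).choose m : ℝ) * (m + 1).factorial)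
      simpa [derivTerm, Function.comp_def] using! this
    · filter_upwards [eventually_ge_atTop 0] with x hx k
      rw [Real.norm_of_nonneg (derivTerm_nonneg m k (by linarith)), derivTerm, derivTerm]
      gcongr
  rw [h0]
  refine h1.congr' ?_
  filter_upwards [eventually_ge_atTop 0] with x hx
  exact (hasSum_derivTerm m (by linarith)).tsum_eq

end MultipleGamma

/-! ### A Bohr–Mollerup uniqueness principle. -/

theorem exists_eq_mul_sub_of_hasDerivAt {u v : ℝ → ℝ} (h : ∀ x, 0 < x → HasDerivAt u (v x) x)
    {x y : ℝ} (hx : 0 < x) (hxy : x < y) : ∃ ξ ∈ Set.Ioo x y, u y - u x = v ξ * (y - x) := by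
  obtain ⟨ξ, hξ, he⟩ := exists_hasDerivAt_eq_slope u v hxy
    (fun t ht => (h t (hx.trans_le ht.1)).continuousAt.continuousWithinAt)
    (fun t ht => h t (hx.trans ht.1))
  refine ⟨ξ, hξ, ?_⟩
  rw [he, div_mul_cancel₀ _ (sub_pos.mpr hxy).ne']

/-- Two functions with the same first difference and nonnegative `(m+1)`-st derivatives, one of
which tends to `0`, differ by a constant. -/
theorem sub_eq_const_of_iteratedDeriv_nonneg {f g : ℝ → ℝ} (m : ℕ)
    (hf : ∀ k x, 0 < x → DifferentiableAt ℝ (iteratedDeriv k f) x)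
    (hg : ∀ k x, 0 < x → DifferentiableAt ℝ (iteratedDeriv k g) x)
    (hper : ∀ x, 0 < x → f (x + 1) - f x = g (x + 1) - g x)
    (hf2 : ∀ x, 0 < x → 0 ≤ iteratedDeriv (m + 1) f x)
    (hg2 : ∀ x, 0 < x → 0 ≤ iteratedDeriv (m + 1) g x)
    (hlim : Tendsto (iteratedDeriv (m + 1) g) atTop (𝓝 0)) {x y : ℝ} (hx : 0 < x) (hy : 0 < y) :
    f x - g x = f y - g y := by
  set h : ℕ → ℝ → ℝ := fun k x => iteratedDeriv k f x - iteratedDeriv k g x with hh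
  have hfd : ∀ k x, 0 < x → HasDerivAt (iteratedDeriv k f) (iteratedDeriv (k + 1) f x) x := by
    intro k x hx; rw [iteratedDeriv_succ]; exact (hf k x hx).hasDerivAt
  have hgd : ∀ k x, 0 < x → HasDerivAt (iteratedDeriv k g) (iteratedDeriv (k + 1) g x) x := by
    intro k x hx; rw [iteratedDeriv_succ]; exact (hg k x hx).hasDerivAt
  have hd : ∀ k x, 0 < x → HasDerivAt (h k) (h (k + 1) x) x := fun k x hx =>
    (hfd k x hx).sub (hgd k x hx)
  -- Equal first differences make f - g, and hence each of its derivatives, 1-periodic.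
  have hp : ∀ k x, 0 < x → h k (x + 1) = h k x := by
    intro k
    induction k with
    | zero => intro x hx; simp only [hh, iteratedDeriv_zero]; linarith [hper x hx]
    | succ k ih =>
      intro x hx
      have h1 := (hd k (x + 1) (by linarith)).comp_add_const x 1
      have h2 : (fun t => h k (t + 1)) =ᶠ[𝓝 x] h k := by
        filter_upwards [lt_mem_nhds hx] with t ht using ih t ht
      exact (h1.congr_of_eventuallyEq h2.symm).unique (hd k x hx)
  have hpN : ∀ k (N : ℕ) x, 0 < x → h k (x + N) = h k x := by
    intro k N x hx
    induction N with
    | zero => simp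
    | succ N ih => rw [← ih, ← hp k (x + N) (by positivity)]; push_cast; ring_nf
  have hmf : MonotoneOn (iteratedDeriv m f) (Set.Ioi 0) := by
    refine monotoneOn_of_deriv_nonneg (convex_Ioi 0)
      (fun t ht => (hf m t ht).continuousAt.continuousWithinAt) ?_ ?_
    · rw [interior_Ioi]; exact fun t ht => (hf m t ht).differentiableWithinAt
    · rw [interior_Ioi]; intro t ht; rw [(hfd m t ht).deriv]; exact hf2 t ht
  have hmg : MonotoneOn (iteratedDeriv m g) (Set.Ioi 0) := by
    refine monotoneOn_of_deriv_nonneg (convex_Ioi 0)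
      (fun t ht => (hg m t ht).continuousAt.continuousWithinAt) ?_ ?_
    · rw [interior_Ioi]; exact fun t ht => (hg m t ht).differentiableWithinAt
    · rw [interior_Ioi]; intro t ht; rw [(hgd m t ht).deriv]; exact hg2 t ht
  have hstep : ∀ x y, 0 < x → x ≤ y → y ≤ x + 1 → h m y = h m x := by
    intro x y hx hxy hyx
    have hε : Tendsto (fun N : ℕ => iteratedDeriv m g (x + N + 1) - iteratedDeriv m g (x + N))
        atTop (𝓝 0) := by
      have h1 : ∀ N : ℕ, ∃ ξ, x + N < ξ ∧
          iteratedDeriv m g (x + N + 1) - iteratedDeriv m g (x + N) = iteratedDeriv (m + 1) g ξ := by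
        intro N
        obtain ⟨ξ, hξ, he⟩ := exists_eq_mul_sub_of_hasDerivAt (hgd m)
          (show 0 < x + N by positivity) (lt_add_one (x + N))
        exact ⟨ξ, hξ.1, by rw [he]; ring⟩
      choose ξ hξ he using h1
      simp only [he]
      refine hlim.comp (tendsto_atTop_mono (fun N => (hξ N).le) ?_)
      exact tendsto_atTop_add_const_left _ _ tendsto_natCast_atTop_atTop
    -- Translate by N. The m-th derivatives of f and g are monotone, so their increments from x+N to
    -- y+N lie between 0 and their increments over a full period; by periodicity of h these full
    -- increments coincide. Decay of g alone therefore suffices.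
    have hb : ∀ N : ℕ, |h m y - h m x| ≤
        iteratedDeriv m g (x + N + 1) - iteratedDeriv m g (x + N) := by
      intro N
      have hN : (0 : ℝ) ≤ N := N.cast_nonneg
      have e1 := hpN m N x hx
      have e2 := hpN m N y (by linarith)
      have e3 := hp m (x + N) (by linarith)
      have m1 := hmf (show x + N ∈ Set.Ioi (0 : ℝ) from by simp; linarith)
        (show y + N ∈ Set.Ioi (0 : ℝ) from by simp; linarith) (by linarith)
      have m2 := hmf (show y + N ∈ Set.Ioi (0 : ℝ) from by simp; linarith)
        (show x + N + 1 ∈ Set.Ioi (0 : ℝ) from by simp; linarith) (by linarith)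
      have m3 := hmg (show x + N ∈ Set.Ioi (0 : ℝ) from by simp; linarith)
        (show y + N ∈ Set.Ioi (0 : ℝ) from by simp; linarith) (by linarith)
      have m4 := hmg (show y + N ∈ Set.Ioi (0 : ℝ) from by simp; linarith)
        (show x + N + 1 ∈ Set.Ioi (0 : ℝ) from by simp; linarith) (by linarith)
      rw [← e1, ← e2]
      simp only [hh] at e3 ⊢
      rw [abs_le]
      constructor <;> linarith
    have h0 : |h m y - h m x| ≤ 0 := ge_of_tendsto' hε hb
    exact sub_eq_zero.mp (abs_nonpos_iff.mp h0)
  have hzero : ∀ x, 0 < x → h (m + 1) x = 0 := by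
    intro x hx
    have h1 : h m =ᶠ[𝓝 x] fun _ => h m x := by
      filter_upwards [lt_mem_nhds hx, Ioo_mem_nhds (sub_one_lt x) (lt_add_one x)] with t ht ht2
      rcases le_total x t with hxt | hxt
      · exact hstep x t hx hxt ht2.2.le
      · exact (hstep t x ht hxt (by linarith [ht2.1])).symm
    exact (hd m x hx).unique ((hasDerivAt_const x _).congr_of_eventuallyEq h1)
  have hconst : ∀ k, (∀ x, 0 < x → h (k + 1) x = 0) → ∀ x y, 0 < x → x < y → h k x = h k y := by
    intro k hk x y hx hxy
    obtain ⟨ξ, hξ, he⟩ := exists_eq_mul_sub_of_hasDerivAt (hd k) hx hxy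
    rw [hk ξ (hx.trans hξ.1)] at he
    linarith
  -- If the derivative of h (i+1) vanishes, then h (i+1) is constant; by the mean value theorem over
  -- one period of h i it has a zero, so the constant is 0.
  have hdesc : ∀ i, (∀ x, 0 < x → h (i + 1) x = 0) → ∀ x, 0 < x → h 1 x = 0 := by
    intro i
    induction i with
    | zero => exact fun h => h
    | succ i ih =>
      intro hi
      refine ih fun x hx => ?_
      obtain ⟨ξ, hξ, he⟩ := exists_eq_mul_sub_of_hasDerivAt (hd i) hx (lt_add_one x)
      rw [hp i x hx] at he
      have : h (i + 1) ξ = 0 := by linarith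
      rw [hconst (i + 1) hi x ξ hx hξ.1, this]
  have h1 := hconst 0 (hdesc m hzero)
  have h2 : h 0 x = h 0 y := by
    rcases lt_trichotomy x y with hlt | rfl | hlt
    · exact h1 x y hx hlt
    · rfl
    · exact (h1 y x hy hlt).symm
  simpa [hh] using h2

namespace MultipleGamma

/-! ### The Weierstrass product as a holomorphic function. -/

/-- The complement of the nonpositive integers. -/
def slitDomain : Set ℂ := {z | ∀ m : ℕ, z ≠ -(m : ℂ)}

theorem compl_slitDomain : slitDomainᶜ = Set.range fun m : ℕ => -(m : ℂ) := by
  ext z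
  simp [slitDomain, eq_comm]

theorem isOpen_slitDomain : IsOpen slitDomain := by
  rw [← isClosed_compl_iff, compl_slitDomain]
  have h : Topology.IsClosedEmbedding fun m : ℕ => -(m : ℂ) :=
    ((Homeomorph.neg ℂ).isClosedEmbedding.comp
      (Complex.isometry_ofReal.isClosedEmbedding)).comp Nat.isClosedEmbedding_coe_real
  exact h.isClosed_range

theorem isPreconnected_slitDomain : IsPreconnected slitDomain := by
  have h : (slitDomainᶜ).Countable := by
    rw [compl_slitDomain]; exact Set.countable_range _
  have := (h.isConnected_compl_of_one_lt_rank (by simp)).isPreconnected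
  rwa [compl_compl] at this

theorem ofReal_mem_slitDomain {x : ℝ} (hx : 0 < x) : (x : ℂ) ∈ slitDomain := by
  intro m h
  have := congrArg Complex.re h
  simp at this
  have : (0 : ℝ) ≤ m := m.cast_nonneg
  linarith

/-- The identity theorem: the domain is connected, as the complement of a countable set, and the
real ray accumulates at 2. -/
theorem eqOn_slitDomain {f g : ℂ → ℂ} (hf : DifferentiableOn ℂ f slitDomain)
    (hg : DifferentiableOn ℂ g slitDomain) (h : ∀ x : ℝ, 1 < x → f x = g x) :
    Set.EqOn f g slitDomain := by
  refine (hf.analyticOnNhd isOpen_slitDomain).eqOn_of_preconnected_of_frequently_eq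
    (hg.analyticOnNhd isOpen_slitDomain) isPreconnected_slitDomain
    (z₀ := ((2 : ℝ) : ℂ)) (ofReal_mem_slitDomain two_pos) ?_
  have ht : Tendsto (fun x : ℝ => (x : ℂ)) (𝓝[≠] 2) (𝓝[≠] ((2 : ℝ) : ℂ)) := by
    refine tendsto_nhdsWithin_of_tendsto_nhds_of_eventually_within _
      (Complex.continuous_ofReal.continuousAt.tendsto.mono_left nhdsWithin_le_nhds) ?_
    filter_upwards [self_mem_nhdsWithin] with x hx
    exact fun h => hx (Complex.ofReal_injective h)
  refine ht.frequently (Eventually.frequently ?_)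
  filter_upwards [nhdsWithin_le_nhds (lt_mem_nhds (show (1 : ℝ) < 2 by norm_num))] with x hx
  exact h x hx

theorem mem_slitDomain_add_one {z : ℂ} : z + 1 ∈ slitDomain ↔ ∀ j : ℕ, z ≠ -((j : ℂ) + 1) := by
  constructor
  · intro h j hj
    exact h j (by rw [hj]; ring)
  · intro h j hj
    exact h j (by linear_combination hj)

theorem weierstrassFactor_eq (m k : ℕ) (z : ℂ) : weierstrassFactor (m + 1) z (k + 1) =
    (1 + z / ((k : ℂ) + 1)) ^ (-Ring.choose (-((k : ℤ) + 1)) m) *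
      Complex.exp (logTrunc z (binomPoly m 0) ((k : ℂ) + 1)) := by
  rw [weierstrassFactor, Phi_succ m z k.succ_ne_zero, Nat.add_sub_cancel]
  push_cast
  rfl

/-- Because the exponent is an integer, the branch of the logarithm is irrelevant and a nonzero base
is all that is needed. -/
theorem weierstrassFactor_eq_exp (m k : ℕ) {z : ℂ} (hz : 1 + z / ((k : ℂ) + 1) ≠ 0) :
    weierstrassFactor (m + 1) z (k + 1) = Complex.exp (logTerm m k z) := by
  rw [weierstrassFactor_eq, logTerm, eval_binomPoly_zero, sub_eq_add_neg, Complex.exp_add,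
    ← neg_mul, ← Int.cast_neg, Complex.exp_int_mul, Complex.exp_log hz, mul_comm]

/-- Once k ≥ R the base cannot vanish, and |e^w - 1| ≤ 2|w| for |w| ≤ 1 transfers the k⁻² bound from
the logarithms to the factors. -/
theorem norm_weierstrassFactor_sub_one_le (m : ℕ) (R : ℝ) : ∃ C : ℝ, ∀ᶠ k : ℕ in atTop, ∀ z : ℂ,
    ‖z‖ ≤ R → ‖weierstrassFactor (m + 1) z (k + 1) - 1‖ ≤ C * (1 / (k : ℝ) ^ 2) := by
  obtain ⟨C, hC⟩ := norm_log_term_le (binomPoly m 0) (le_max_right R 0)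
  refine ⟨2 * C, ?_⟩
  have h1 : ∀ᶠ k : ℕ in atTop, C * (1 / (k : ℝ) ^ 2) < 1 := by
    have h2 : Tendsto (fun k : ℕ => C * (1 / (k : ℝ) ^ 2)) atTop (𝓝 (C * 0)) :=
      (Real.summable_one_div_nat_pow.mpr one_lt_two).tendsto_atTop_zero.const_mul C
    exact h2.eventually (gt_mem_nhds (by simp))
  filter_upwards [hC, h1, eventually_ge_atTop ⌈R⌉₊] with k hk hk1 hkR z hz
  have hkR' : R ≤ k := (Nat.le_ceil R).trans (by exact_mod_cast hkR)
  have hne : 1 + z / ((k : ℂ) + 1) ≠ 0 := by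
    intro h
    have h3 : z = -((k + 1 : ℕ) : ℂ) := by
      have := natCast_add_one_ne_zero k
      field_simp at h
      push_cast
      linear_combination h
    rw [h3, norm_neg, Complex.norm_natCast] at hz
    push_cast at hz
    linarith
  have h4 := hk z (hz.trans (le_max_left _ _))
  rw [norm_sub_rev, ← logTerm] at h4
  rw [weierstrassFactor_eq_exp m k hne]
  refine (Complex.norm_exp_sub_one_le (h4.trans hk1.le)).trans ?_
  linarith

theorem summable_weierstrassFactor (m : ℕ) (z : ℂ) :
    Summable fun k : ℕ => ‖weierstrassFactor (m + 1) z (k + 1) - 1‖ := by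
  obtain ⟨C, hC⟩ := norm_weierstrassFactor_sub_one_le m ‖z‖
  refine Summable.of_norm_bounded_eventually_nat (g := fun k : ℕ => C * (1 / (k : ℝ) ^ 2))
    ((Real.summable_one_div_nat_pow.mpr one_lt_two).mul_left C) ?_
  filter_upwards [hC] with k hk
  rw [norm_norm]
  exact hk z le_rfl

theorem isOpen_preimage_slitDomain : IsOpen {z : ℂ | z + 1 ∈ slitDomain} :=
  isOpen_slitDomain.preimage (continuous_id.add continuous_const)

theorem differentiableOn_weierstrassFactor (m k : ℕ) :
    DifferentiableOn ℂ (fun z => weierstrassFactor (m + 1) z (k + 1)) {z | z + 1 ∈ slitDomain} := by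
  simp only [weierstrassFactor_eq]
  have h1 := (isPolyLE_logTrunc_binomPoly m (natCast_add_one_ne_zero k)).differentiable
  intro z hz
  have h2 : 1 + z / ((k : ℂ) + 1) ≠ 0 := by
    intro h
    have hk := natCast_add_one_ne_zero k
    field_simp at h
    exact mem_slitDomain_add_one.mp hz k (by linear_combination h)
  refine DifferentiableAt.differentiableWithinAt (DifferentiableAt.mul ?_ (h1 z).cexp)
  exact DifferentiableAt.zpow (by fun_prop) (Or.inl h2)

theorem differentiableOn_tprod_weierstrassFactor (m : ℕ) : DifferentiableOn ℂ
    (fun z => ∏' k : ℕ, weierstrassFactor (m + 1) z (k + 1)) {z | z + 1 ∈ slitDomain} := by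
  intro z hz
  obtain ⟨C, hC⟩ := norm_weierstrassFactor_sub_one_le m (‖z‖ + 1)
  -- The k⁻² bound is uniform only on bounded sets, so the product is treated on a bounded open
  -- neighbourhood of z.
  set K : Set ℂ := {z | z + 1 ∈ slitDomain} ∩ Metric.ball 0 (‖z‖ + 1) with hK
  have hKo : IsOpen K := isOpen_preimage_slitDomain.inter Metric.isOpen_ball
  have hzK : z ∈ K := ⟨hz, by simp⟩
  have hd : ∀ k, DifferentiableOn ℂ (fun z => weierstrassFactor (m + 1) z (k + 1)) K := fun k =>
    (differentiableOn_weierstrassFactor m k).mono Set.inter_subset_left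
  have hprod := Summable.hasProdLocallyUniformlyOn_nat_one_add
    (f := fun k z => weierstrassFactor (m + 1) z (k + 1) - 1) hKo
    ((Real.summable_one_div_nat_pow.mpr one_lt_two).mul_left C)
    (by filter_upwards [hC] with k hk w hw
        exact hk w (by have := hw.2; simp at this; exact this.le))
    (fun k => ((hd k).sub_const 1).continuousOn)
  simp only [add_sub_cancel] at hprod
  have hdiff := (hasProdLocallyUniformlyOn_iff_tendstoLocallyUniformlyOn.mp hprod).differentiableOn
    (.of_forall fun s => by
      have := DifferentiableOn.fun_finsetProd (u := s) (fun k _ => hd k)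
      simpa using this) hKo
  exact (hdiff.differentiableAt (hKo.mem_nhds hzK)).differentiableWithinAt

/-- The Weierstrass product for `G_{m+1}(z + 1)`. -/
noncomputable def weierstrassProduct (m : ℕ) (z : ℂ) : ℂ :=
  Complex.exp (F (m + 1) z) * ∏' k : ℕ, weierstrassFactor (m + 1) z (k + 1)

theorem differentiableOn_weierstrassProduct (m : ℕ) :
    DifferentiableOn ℂ (weierstrassProduct m) {z | z + 1 ∈ slitDomain} :=
  (isPolyLE_F m).differentiable.cexp.differentiableOn.mul
    (differentiableOn_tprod_weierstrassFactor m)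

theorem weierstrassProduct_ofReal (m : ℕ) {x : ℝ} (hx : -1 < x) :
    weierstrassProduct m x = Complex.exp (logMultipleGamma m x) := by
  rw [logMultipleGamma_eq m hx, Complex.exp_add, weierstrassProduct]
  congr 1
  have h : Summable fun k => logTerm m k x := by
    have := (summable_log_term (binomPoly m 0) x).neg
    simpa [logTerm] using this
  rw [← h.hasSum.cexp.tprod_eq]
  refine tprod_congr fun k => ?_
  rw [Function.comp_apply, weierstrassFactor_eq_exp]
  exact Complex.slitPlane_ne_zero (one_add_div_mem_slitPlane (ofReal_mem_rightHalf.mpr hx) k)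

theorem weierstrassProduct_ofReal' (m : ℕ) {x : ℝ} (hx : -1 < x) :
    weierstrassProduct m x = ((Real.exp (logW m x).re : ℝ) : ℂ) := by
  have h : logW m x = logMultipleGamma m x := (logMultipleGamma_eq m hx).symm
  rw [weierstrassProduct_ofReal m hx, h, Complex.ofReal_exp]
  congr 1
  apply Complex.ext <;> simp [logMultipleGamma_im m hx]

/-! ### Existence of a hierarchy. -/

/-- The canonical hierarchy of multiple gamma functions. -/
noncomputable def multipleGamma : ℕ → ℂ → ℂ
  | 0, z => z
  | m + 1, z => weierstrassProduct m (z - 1)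

theorem multipleGamma_succ_add_one (m : ℕ) (z : ℂ) :
    multipleGamma (m + 1) (z + 1) = weierstrassProduct m z := by
  rw [multipleGamma, add_sub_cancel_right]

theorem differentiableOn_multipleGamma (n : ℕ) :
    DifferentiableOn ℂ (multipleGamma n) slitDomain := by
  cases n with
  | zero => exact differentiable_id.differentiableOn
  | succ m =>
    refine (differentiableOn_weierstrassProduct m).comp
      (differentiable_id.sub_const 1).differentiableOn fun z hz => ?_
    simpa using hz

theorem multipleGamma_ofReal_add_one (m : ℕ) {x : ℝ} (hx : 0 < x) :
    multipleGamma (m + 1) ((x : ℂ) + 1) = multipleGamma m x * multipleGamma (m + 1) x := by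
  have hx1 : -1 < x := by linarith
  have hx2 : -1 < x - 1 := by linarith
  rw [multipleGamma_succ_add_one, weierstrassProduct_ofReal m hx1]
  have e : ∀ k, multipleGamma (k + 1) x = Complex.exp (logMultipleGamma k (x - 1)) := by
    intro k
    rw [← weierstrassProduct_ofReal k hx2, multipleGamma]
    push_cast; rfl
  cases m with
  | zero =>
    have h := logMultipleGamma_zero_add_one hx2
    rw [sub_add_cancel] at h
    rw [e, h, Complex.exp_add, ← Complex.ofReal_exp, Real.exp_log hx, multipleGamma, mul_comm]
  | succ m =>
    have h := logMultipleGamma_succ_add_one m hx2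
    rw [sub_add_cancel] at h
    rw [e, e, h, Complex.exp_add, mul_comm]

theorem isMultipleGammaHierarchy_multipleGamma : IsMultipleGammaHierarchy multipleGamma where
  holomorphic := differentiableOn_multipleGamma
  zero z := rfl
  add_one m z hz := by
    have h1 : DifferentiableOn ℂ (fun z => multipleGamma (m + 1) (z + 1)) slitDomain := by
      simp only [multipleGamma_succ_add_one]
      refine (differentiableOn_weierstrassProduct m).mono fun z hz => ?_
      rw [Set.mem_ofPred_eq, mem_slitDomain_add_one]
      intro j
      exact_mod_cast hz (j + 1)
    -- The recursion is known on the real axis from `logMultipleGamma` and extends by the identity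
    -- theorem.
    exact eqOn_slitDomain h1
      ((differentiableOn_multipleGamma m).mul (differentiableOn_multipleGamma (m + 1)))
      (fun x hx => multipleGamma_ofReal_add_one m (by linarith)) hz
  one n := by
    cases n with
    | zero => rfl
    | succ m =>
      have := weierstrassProduct_ofReal m (show (-1 : ℝ) < 0 by norm_num)
      rw [logMultipleGamma_zero, Complex.exp_zero] at this
      rw [multipleGamma, sub_self, ← this, Complex.ofReal_zero]
  real_pos n x hx := by
    cases n with
    | zero => simp [multipleGamma]; linarith
    | succ m =>
      rw [multipleGamma_succ_add_one, weierstrassProduct_ofReal' m (by linarith)]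
      exact ⟨Complex.ofReal_im _, Real.exp_pos _⟩
  log_deriv_nonneg n x hx := by
    have hmem : ∀ᶠ t : ℝ in 𝓝 x, -1 < t := lt_mem_nhds (by linarith)
    cases n with
    | zero =>
      rw [zero_add, iteratedDeriv_one]
      have h1 : HasDerivAt (fun t : ℝ => Real.log (t + 1)) (1 / (x + 1)) x :=
        ((hasDerivAt_id x).add_const 1).log (by simp; linarith)
      have h2 : (fun t : ℝ => Real.log (multipleGamma 0 ((t : ℂ) + 1)).re) =
          fun t : ℝ => Real.log (t + 1) := by
        ext t; simp [multipleGamma]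
      rw [h2, h1.deriv]
      positivity
    | succ m =>
      have he : (fun t : ℝ => Real.log (multipleGamma (m + 1) ((t : ℂ) + 1)).re) =ᶠ[𝓝 x]
          fun t : ℝ => (logW m t).re := by
        filter_upwards [hmem] with t ht
        rw [multipleGamma_succ_add_one, weierstrassProduct_ofReal' m ht, Complex.ofReal_re,
          Real.log_exp]
      rw [he.iteratedDeriv_eq]
      exact iteratedDeriv_logW_nonneg m (by linarith)

theorem tendsto_iteratedDeriv_log_multipleGamma (m : ℕ) :
    Tendsto (iteratedDeriv (m + 2)
      (fun t : ℝ => Real.log (multipleGamma (m + 1) ((t : ℂ) + 1)).re)) atTop (𝓝 0) := by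
  refine (tendsto_iteratedDeriv_logW m).congr' ?_
  filter_upwards [eventually_gt_atTop 0] with x hx
  refine (Filter.EventuallyEq.iteratedDeriv_eq _ ?_).symm
  filter_upwards [lt_mem_nhds (show -1 < x by linarith)] with t ht
  rw [multipleGamma_succ_add_one, weierstrassProduct_ofReal' m ht, Complex.ofReal_re,
    Real.log_exp]

end MultipleGamma

/-! ### Uniqueness of the hierarchy and the product formula. -/

namespace IsMultipleGammaHierarchy

variable {G : ℕ → ℂ → ℂ}

theorem contDiffAt_log (hG : IsMultipleGammaHierarchy G) (n k : ℕ) {x : ℝ} (hx : 0 ≤ x) :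
    ContDiffAt ℝ k (fun t : ℝ => Real.log (G n ((t : ℂ) + 1)).re) x := by
  have h1 : (x : ℂ) + 1 ∈ slitDomain := by
    have := ofReal_mem_slitDomain (x := x + 1) (by linarith)
    push_cast at this; exact this
  have h2 : ContDiffAt ℝ k (G n) ((x : ℂ) + 1) :=
    (contDiffAt_of_differentiableOn isOpen_slitDomain (hG.holomorphic n) h1 k).restrict_scalars ℝ
  have h3 : ContDiff ℝ k (fun t : ℝ => (t : ℂ) + 1) :=
    Complex.ofRealCLM.contDiff.add contDiff_const
  have h4 : ContDiffAt ℝ k (fun t : ℝ => G n ((t : ℂ) + 1)) x :=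
    ContDiffAt.comp x h2 h3.contDiffAt
  have h5 : ContDiffAt ℝ k (fun t : ℝ => (G n ((t : ℂ) + 1)).re) x :=
    (Complex.reCLM.contDiff.contDiffAt).comp x h4
  exact h5.log (hG.real_pos n x hx).2.ne'

theorem log_add_one (hG : IsMultipleGammaHierarchy G) (n : ℕ) {x : ℝ} (hx : 0 ≤ x) :
    Real.log (G (n + 1) (((x + 1 : ℝ) : ℂ) + 1)).re =
      Real.log (G n ((x : ℂ) + 1)).re + Real.log (G (n + 1) ((x : ℂ) + 1)).re := by
  have h1 : (x : ℂ) + 1 ∈ slitDomain := by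
    have := ofReal_mem_slitDomain (x := x + 1) (by linarith)
    push_cast at this; exact this
  have h2 := hG.real_pos n x hx
  have h3 := hG.real_pos (n + 1) x hx
  push_cast
  rw [hG.add_one n _ h1, Complex.mul_re, h2.1, zero_mul, sub_zero, Real.log_mul h2.2.ne' h3.2.ne']

/-- By the induction hypothesis the logarithms at level n+1 have the same first difference as the
canonical ones. The uniqueness principle makes them differ by a constant, the normalisation makes it
0, and the identity theorem leaves the real axis. -/
theorem eqOn_multipleGamma (hG : IsMultipleGammaHierarchy G) (n : ℕ) :
    Set.EqOn (G n) (multipleGamma n) slitDomain := by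
  have hM := isMultipleGammaHierarchy_multipleGamma
  induction n with
  | zero => intro z _; rw [hG.zero, hM.zero]
  | succ n ih =>
    refine eqOn_slitDomain (hG.holomorphic _) (hM.holomorphic _) fun x hx => ?_
    have hdiff : ∀ {H : ℕ → ℂ → ℂ}, IsMultipleGammaHierarchy H → ∀ (k : ℕ) (x : ℝ), 0 < x →
        DifferentiableAt ℝ
          (iteratedDeriv k (fun t : ℝ => Real.log (H (n + 1) ((t : ℂ) + 1)).re)) x := by
      intro H hH k x hx
      have := (hH.contDiffAt_log (n + 1) (k + 1) hx.le).contDiffWithinAt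
        (s := Set.univ) |>.differentiableWithinAt_iteratedDerivWithin
        (Nat.cast_lt.mpr k.lt_succ_self) (by simp)
      rwa [iteratedDerivWithin_univ, differentiableWithinAt_univ] at this
    -- The uniqueness principle covers x > 0 only, so the constant is read off at x = 1 from
    -- H_{n+1}(2) = H_n(1) H_{n+1}(1) = 1 rather than at x = 0.
    have hone : ∀ {H : ℕ → ℂ → ℂ}, IsMultipleGammaHierarchy H →
        Real.log (H (n + 1) (((1 : ℝ) : ℂ) + 1)).re = 0 := by
      intro H hH
      have := hH.log_add_one n (le_refl (0 : ℝ))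
      simpa [hH.one] using this
    have key := sub_eq_const_of_iteratedDeriv_nonneg (n + 1) (hdiff hG) (hdiff hM)
      (fun y hy => ?_)
      (fun y hy => hG.log_deriv_nonneg (n + 1) y hy.le)
      (fun y hy => hM.log_deriv_nonneg (n + 1) y hy.le)
      (tendsto_iteratedDeriv_log_multipleGamma n) (show 0 < x - 1 by linarith) one_pos
    · rw [hone hG, hone hM, sub_self, sub_eq_zero] at key
      have h1 := hG.real_pos (n + 1) (x - 1) (by linarith)
      have h2 := hM.real_pos (n + 1) (x - 1) (by linarith)
      have h3 := Real.log_injOn_pos h1.2 h2.2 key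
      have h4 := Complex.ext h3 (h1.1.trans h2.1.symm)
      push_cast at h4
      simpa using h4
    · have h1 : (y : ℂ) + 1 ∈ slitDomain := by
        have := ofReal_mem_slitDomain (x := y + 1) (by linarith)
        push_cast at this; exact this
      rw [hG.log_add_one n hy.le, hM.log_add_one n hy.le, ih h1]
      ring

end IsMultipleGammaHierarchy

end

theorem theorem5p1 :
    (∃ G : ℕ → ℂ → ℂ, IsMultipleGammaHierarchy G) ∧
    ∀ G : ℕ → ℂ → ℂ, IsMultipleGammaHierarchy G →
      ∀ n : ℕ, 1 ≤ n → ∀ z : ℂ, (∀ m : ℕ, z ≠ -((m : ℂ) + 1)) →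
        Summable (fun k : ℕ => ‖MultipleGamma.weierstrassFactor n z (k + 1) - 1‖) ∧
        G n (z + 1) =
          Complex.exp (MultipleGamma.F n z) *
            ∏' k : ℕ, MultipleGamma.weierstrassFactor n z (k + 1) := by
  refine ⟨⟨MultipleGamma.multipleGamma, MultipleGamma.isMultipleGammaHierarchy_multipleGamma⟩, fun G hG n hn z hz => ?_⟩
  obtain ⟨m, rfl⟩ := Nat.exists_eq_add_of_le' hn
  refine ⟨MultipleGamma.summable_weierstrassFactor m z, ?_⟩
  rw [hG.eqOn_multipleGamma (m + 1) (MultipleGamma.mem_slitDomain_add_one.mpr hz),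
    MultipleGamma.multipleGamma_succ_add_one, MultipleGamma.weierstrassProduct]
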